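/- Let $G$ be a connected (finite-dimensional) Lie group acting smoothly and properly on a smooth finite-dimensional manifold $P$ (Hausdorff, paracompact, without boundary), with action $\phi_g(p)=gp$ and orbit map $\rho:P\to \bar P=P/G$. Give $\bar P$ the quotient topology and let $C^\infty(\bar P)$ be the set of functions $f:\bar P\to\mathbb R$ with $f\circ\rho\in C^\infty(P)$. A differential space is a topological space $M$ with an algebra $C^\infty(M)$ of continuous real functions such that (i) the sets $f^{-1}(I)$, with $f\in C^\infty(M)$ and $I$ an open interval, form a subbasis of the topology, (ii) $F(f_1,\dots,f_n)\in C^\infty(M)$ whenever $f_1,\dots,f_n\in C^\infty(M)$ and $F\in C^\infty(\mathbb R^n)$, and (iii) a function that agrees near each point with an element of $C^\infty(M)$ lies in $C^\infty(M)$. An integral curve through $x\in M$ of a derivation $Y$ of the $\mathbb R$-algebra $C^\infty(M)$ is a map $c:J\to M$ on an interval $J\ni 0$ (not necessarily open; derivatives at end points are one-sided) with $c(0)=x$ and $\frac{d}{dt}f(c(t))=(Yf)(c(t))$ for all $f\in C^\infty(M)$ and $t\in J$. The derivation $Y$ is a vector field if through every point there is a unique maximal integral curve (one of which every integral curve through that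 point is a restriction) and the resulting maps $\exp tY$, where $(\exp tY)(x)$ is the value at $t$ of that curve through $x$, form a continuous local one-parameter group of local diffeomorphisms: the set of $(t,x)$ for which $(\exp tY)(x)$ is defined is open in $\mathbb R\times M$, the map $(t,x)\mapsto(\exp tY)(x)$ is continuous on it, $\exp 0Y=\mathrm{id}$, $\exp (s+t)Y=\exp sY\circ\exp tY$ wherever the right-hand side is defined, and each $\exp tY$ is a diffeomorphism from its open domain onto the domain of $\exp(-tY)$. Let $X$ be a smooth vector field on $P$ such that for every $g\in G$ and $p\in P$ the vector $(\phi_{g*}X-X)(p)$ lies in the tangent space at $p$ of the orbit $Gp$, where $\phi_{g*}X(p)=T\phi_g\bigl(X(g^{-1}p)\bigr)$. Then $(\bar P,C^\infty(\bar P))$ is a differential space, and $X$ descends to a vector field on it: there is a unique derivation $\bar X=\rho_*X$ of $C^\infty(\bar P)$ with $(\bar X f)\circ\rho=X(f\circ\rho)$ for all $f\in C^\infty(\bar P)$, this $\bar X$ is a vector field on $\bar P$, and $\rho\circ\exp tX=\exp t\bar X\circ\rho$ wherever $\exp tX$ is defined; that is, if an integral curve of $X$ with $\gamma(0)=p$ is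 defined at $t$, then $(\exp t\bar X)(\rho(p))$ is defined and equals $\rho(\gamma(t))$. -/

import Mathlib

open scoped Manifold ContDiff Topology

/-!
### Differential spaces

A differential space is a topological space `M` together with an algebra `A` of real functions on
it, the smooth functions.
-/

namespace DiffSpace

section General

variable {M : Type*} [τ : TopologicalSpace M]

/-- The algebra `A` of functions on the topological space `M` makes `M` a differential space. -/
structure IsDifferentialStructure (A : Subalgebra ℝ (M → ℝ)) : Prop where
  continuous : ∀ f ∈ A, Continuous f
  /-- Preimages of open intervals under smooth functions form a subbasis of the topology. -/
  subbasis : τ =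
    TopologicalSpace.generateFrom {U | ∃ f ∈ A, ∃ a b : ℝ, U = f ⁻¹' Set.Ioo a b}
  /-- Smooth functions of finitely many smooth functions are smooth. -/
  comp_mem : ∀ (n : ℕ) (F : (Fin n → ℝ) → ℝ), ContDiff ℝ ∞ F →
    ∀ f : Fin n → M → ℝ, (∀ i, f i ∈ A) → (fun x => F (fun i => f i x)) ∈ A
  /-- A function that locally agrees with smooth functions is smooth. -/
  local_mem : ∀ f : M → ℝ,
    (∀ x, ∃ U : Set M, IsOpen U ∧ x ∈ U ∧ ∃ g ∈ A, Set.EqOn f g U) → f ∈ A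

/-- `φ` restricted to the differential subspace `U` is smooth: the pull-back of a smooth function
is, near each point of `U`, the restriction to `U` of a smooth function. -/
def SmoothOn (A : Subalgebra ℝ (M → ℝ)) (φ : M → M) (U : Set M) : Prop :=
  ∀ f ∈ A, ∀ x ∈ U, ∃ V : Set M, IsOpen V ∧ x ∈ V ∧ ∃ g ∈ A, ∀ y ∈ V ∩ U, f (φ y) = g y

/-- `φ` restricts to a diffeomorphism of the open set `U` onto the open set `V`. -/
def IsDiffeoOn (A : Subalgebra ℝ (M → ℝ)) (φ : M → M) (U V : Set M) : Prop :=
  IsOpen U ∧ IsOpen V ∧ ∃ ψ : M → M, Set.MapsTo φ U V ∧ Set.MapsTo ψ V U ∧ Set.InvOn ψ φ U V ∧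
    ContinuousOn φ U ∧ ContinuousOn ψ V ∧ SmoothOn A φ U ∧ SmoothOn A ψ V

end General

section Flow

variable {M : Type*} {A : Subalgebra ℝ (M → ℝ)}

/-- `c`, restricted to the interval `J ∋ 0`, is an integral curve through `x` of the derivation `X`:
`d/dt f (c t) = (X f) (c t)` for all smooth `f`. The interval may be open, closed or half-open;
derivatives at end points are one-sided. Values of `c` off `J` are irrelevant. -/
structure IsIntegralCurve (X : Derivation ℝ A A) (x : M) (c : ℝ → M) (J : Set ℝ) : Prop where
  ordConnected : J.OrdConnected
  zero_mem : (0 : ℝ) ∈ J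
  map_zero : c 0 = x
  hasDeriv : ∀ f : A, ∀ t ∈ J,
    HasDerivWithinAt (fun s => (f : M → ℝ) (c s)) ((X f : M → ℝ) (c t)) J t

/-- `c` on `J` is the unique maximal integral curve of `X` through `x`: every integral curve
through `x` is a restriction of it. -/
def IsMaximalIntegralCurve (X : Derivation ℝ A A) (x : M) (c : ℝ → M) (J : Set ℝ) : Prop :=
  IsIntegralCurve X x c J ∧
    ∀ (c' : ℝ → M) (J' : Set ℝ), IsIntegralCurve X x c' J' → J' ⊆ J ∧ Set.EqOn c' c J'

/-- The points `x` for which `(exp tX) x` is defined. -/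
def expDomain (X : Derivation ℝ A A) (t : ℝ) : Set M :=
  {x | ∃ (c : ℝ → M) (J : Set ℝ), IsIntegralCurve X x c J ∧ t ∈ J}

open Classical in
/-- `(exp tX) x`: the point with parameter `t` on an integral curve of `X` through `x`. It is
meaningful on `expDomain X t` when maximal integral curves are unique; it is `x` elsewhere. -/
noncomputable def exp (X : Derivation ℝ A A) (t : ℝ) (x : M) : M :=
  if h : ∃ (c : ℝ → M) (J : Set ℝ), IsIntegralCurve X x c J ∧ t ∈ J then h.choose t else x

/-- The derivation `X` is a vector field: it has a unique maximal integral curve through each point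
and `exp tX` is a local one-parameter group of local diffeomorphisms. -/
structure IsVectorField [TopologicalSpace M] (X : Derivation ℝ A A) : Prop where
  exists_maximal : ∀ x : M, ∃ (c : ℝ → M) (J : Set ℝ), IsMaximalIntegralCurve X x c J
  isOpen_domain : IsOpen {z : ℝ × M | z.2 ∈ expDomain X z.1}
  continuousOn_exp :
    ContinuousOn (fun z : ℝ × M => exp X z.1 z.2) {z : ℝ × M | z.2 ∈ expDomain X z.1}
  exp_zero : ∀ x : M, x ∈ expDomain X 0 ∧ exp X 0 x = x
  exp_add : ∀ (s t : ℝ) (x : M), x ∈ expDomain X t → exp X t x ∈ expDomain X s →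
    x ∈ expDomain X (s + t) ∧ exp X (s + t) x = exp X s (exp X t x)
  /-- `exp tX` is a diffeomorphism of its (open) domain onto the domain of `exp (-t)X`. -/
  isDiffeoOn_exp : ∀ t : ℝ, IsDiffeoOn A (exp X t) (expDomain X t) (expDomain X (-t))

end Flow

end DiffSpace

/-! ### Group actions on manifolds -/

section Action

variable {E : Type*} [NormedAddCommGroup E] [NormedSpace ℝ E]
  {H : Type*} [TopologicalSpace H] (I : ModelWithCorners ℝ E H)
  (G : Type*) [Group G]
  {P : Type*} [TopologicalSpace P] [ChartedSpace H P] [MulAction G P]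

/-- The orbit map `ρ : P → P/G`. -/
def orbitMap (p : P) : MulAction.orbitRel.Quotient G P := Quotient.mk _ p

variable (P) in
/-- The smooth functions on `P/G`: those `f` for which `f ∘ ρ` is smooth on `P`; they are the
push-forwards of the smooth `G`-invariant functions on `P`. -/
def orbitSpaceSmooth : Subalgebra ℝ (MulAction.orbitRel.Quotient G P → ℝ) where
  carrier := {f | ContMDiff I 𝓘(ℝ, ℝ) ∞ (fun p : P => f (orbitMap G p))}
  mul_mem' hf hg := ContMDiff.mul (I := 𝓘(ℝ, ℝ)) hf hg
  add_mem' hf hg := ContMDiff.add (I := 𝓘(ℝ, ℝ)) hf hg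
  algebraMap_mem' _ := contMDiff_const

variable {G}

/-- The push-forward `(φ_g)_* X`, that is `p ↦ Tφ_g (X (g⁻¹ p))`, of a vector field by the action of
`g`. The value lies in the tangent space at `g (g⁻¹ p) = p`. -/
noncomputable def pushforwardAction (g : G) (X : (p : P) → TangentSpace I p) (p : P) :
    TangentSpace I p :=
  mfderiv I I (fun q : P => g • q) (g⁻¹ • p) (X (g⁻¹ • p))

variable (G) in
/-- The tangent space at `p` of the orbit of `p`: the range of the differential at the identity of
`g ↦ g p`. The values of this differential lie in the tangent space at `1 p = p`. -/
noncomputable def orbitTangentSpace {EG : Type*} [NormedAddCommGroup EG] [NormedSpace ℝ EG]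
    {HG : Type*} [TopologicalSpace HG] (IG : ModelWithCorners ℝ EG HG)
    [TopologicalSpace G] [ChartedSpace HG G] (p : P) : Set (TangentSpace I p) :=
  Set.range (fun v : TangentSpace IG (1 : G) =>
    (mfderiv IG I (fun g : G => g • p) 1 v : TangentSpace I ((1 : G) • p)))

/-- The derivation `Y` of the smooth functions on `P/G` is the push-forward `ρ_* X`:
`(Y f) ∘ ρ = X (f ∘ ρ)` for all smooth `f` on `P/G`. -/
def IsPushforwardToOrbitSpace (X : (p : P) → TangentSpace I p)
    (Y : Derivation ℝ (orbitSpaceSmooth I G P) (orbitSpaceSmooth I G P)) : Prop :=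
  ∀ (f : orbitSpaceSmooth I G P) (p : P),
    (Y f : MulAction.orbitRel.Quotient G P → ℝ) (orbitMap G p) =
      mfderiv I 𝓘(ℝ, ℝ)
        (fun q : P => (f : MulAction.orbitRel.Quotient G P → ℝ) (orbitMap G q)) p (X p)

end Action

/-! The difficulty is that `X` is invariant only modulo directions tangent to the orbits, so its own
flow need not commute with `G`. The differential of an invariant function `F` kills those
directions. Hence `dF(g_* X) = dF(X)`, the function `X F` is again invariant, and the derivation
`Xbar` exists (`diff_pushVec`, `diff_smul_field`, `exists_isPushforwardToOrbitSpace`).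

To integrate `Xbar`, replace `X` near a point by an equivariant field. Take a bump `χ` and average
`χ(g⁻¹ p) (g_* X)(p)` over `G` with left Haar measure. Properness makes the integrand compactly
supported in `g`, so the average is smooth, and left invariance makes it equivariant. Against an
invariant `F` it gives `w · dF(X)` with `w(p) = ∫ χ(g⁻¹ p)`. Dividing by `w`, smoothly cut off away
from the point, yields an equivariant `Z` with `dF(Z) = dF(X)` nearby (`exists_equivariant_field`).
The local flow of `Z` respects orbits, so it descends to a flow box of `Xbar` (`hasFlowBoxes`). The
same averages of bumps give invariant bump functions, and with them the axioms of a differential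
space.

The rest is a statement about Hausdorff differential spaces: a derivation with a flow box around
each point is a vector field (`HasFlowBoxes.isVectorField`). An integral curve `c` must follow the
box because `Φ (-t) (c t)` has derivative zero against every smooth function, and smooth functions
separate points. Local uniqueness then gives maximal curves by gluing, and smoothness of `exp tX`
spreads along a curve box by box. The quotient is Hausdorff because the action is proper.

Smooth dependence of flows on initial values is obtained from the implicit function theorem for the
integral equation in a space of continuous curves (`exists_smooth_flow`). -/

namespace DiffSpace

open Set Filter

/-! ### Integral curves of a derivation: translation in time and gluing -/

section Curves

variable {M : Type*} {A : Subalgebra ℝ (M → ℝ)} {X : Derivation ℝ A A}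
  {x : M} {c c₁ c₂ : ℝ → M} {J J₁ J₂ : Set ℝ} {t : ℝ}

lemma IsIntegralCurve.congr (h : IsIntegralCurve X x c J) (he : EqOn c₁ c J) :
    IsIntegralCurve X x c₁ J :=
  ⟨h.ordConnected, h.zero_mem, (he h.zero_mem).trans h.map_zero, fun f t ht => by
    rw [he ht]
    exact (h.hasDeriv f t ht).congr (fun s hs => by rw [he hs]) (by rw [he ht])⟩

lemma IsIntegralCurve.shift (h : IsIntegralCurve X x c J) (ht : t ∈ J) :
    IsIntegralCurve X (c t) (fun s => c (s + t)) ((fun s => s + t) ⁻¹' J) where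
  ordConnected := by
    refine ⟨fun a ha b hb z hz => h.ordConnected.out ha hb ?_⟩
    exact ⟨add_le_add_left hz.1 t, add_le_add_left hz.2 t⟩
  zero_mem := by simpa using ht
  map_zero := by simp
  hasDeriv f s hs := by
    have h1 := h.hasDeriv f (s + t) hs
    have h2 : HasDerivWithinAt (fun s : ℝ => s + t) 1 ((fun s => s + t) ⁻¹' J) s :=
      (hasDerivWithinAt_id s _).add_const t
    have := HasDerivWithinAt.scomp s h1 h2 (mapsTo_preimage _ _)
    simpa [Function.comp_def] using this

/-- All of `J₂` near `s` lies on the side of `t`, hence between `s` and `t` and so in `J₁`. In a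
glued curve this lets the derivative at a point of only one piece be computed within that piece. -/
lemma eventually_mem_of_ordConnected (h₁ : J₁.OrdConnected) (h₂ : J₂.OrdConnected)
    (ht₁ : t ∈ J₁) (ht₂ : t ∈ J₂) {s : ℝ} (hs₁ : s ∈ J₁) (hs₂ : s ∉ J₂) : J₁ ∈ 𝓝[J₂] s := by
  rcases lt_trichotomy s t with hst | rfl | hst
  · filter_upwards [inter_mem_nhdsWithin J₂ (Iio_mem_nhds hst)] with y hy
    rcases le_total y s with hys | hys
    · exact absurd (h₂.out hy.1 ht₂ ⟨hys, hst.le⟩) hs₂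
    · exact h₁.out hs₁ ht₁ ⟨hys, le_of_lt hy.2⟩
  · exact absurd ht₂ hs₂
  · filter_upwards [inter_mem_nhdsWithin J₂ (Ioi_mem_nhds hst)] with y hy
    rcases le_total y s with hys | hys
    · exact h₁.out ht₁ hs₁ ⟨le_of_lt hy.2, hys⟩
    · exact absurd (h₂.out ht₂ hy.1 ⟨hst.le, hys⟩) hs₂

lemma ordConnected_union (h₁ : J₁.OrdConnected) (h₂ : J₂.OrdConnected)
    (ht₁ : t ∈ J₁) (ht₂ : t ∈ J₂) : (J₁ ∪ J₂).OrdConnected :=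
  (IsPreconnected.union t ht₁ ht₂ h₁.isPreconnected h₂.isPreconnected).ordConnected

lemma IsIntegralCurve.glue (h₁ : IsIntegralCurve X x c₁ J₁) (ht : t ∈ J₁)
    (h₂ : IsIntegralCurve X (c₁ t) c₂ J₂) (he : ∀ s ∈ J₁, s - t ∈ J₂ → c₁ s = c₂ (s - t)) :
    ∃ c, IsIntegralCurve X x c (J₁ ∪ (fun s => s - t) ⁻¹' J₂) ∧ EqOn c c₁ J₁ ∧
      ∀ s, s - t ∈ J₂ → c s = c₂ (s - t) := by
  classical
  let c : ℝ → M := fun s => if s ∈ J₁ then c₁ s else c₂ (s - t)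
  have e₁ : EqOn c c₁ J₁ := fun s hs => by simp [c, hs]
  have e₂ : ∀ s, s - t ∈ J₂ → c s = c₂ (s - t) := fun s hs => by
    by_cases h : s ∈ J₁
    · simp [c, h, he s h hs]
    · simp [c, h]
  have o₂ : ((fun s => s - t) ⁻¹' J₂).OrdConnected := by
    refine ⟨fun a ha b hb z hz => h₂.ordConnected.out ha hb ?_⟩
    exact ⟨sub_le_sub_right hz.1 t, sub_le_sub_right hz.2 t⟩
  have t₂ : t ∈ (fun s => s - t) ⁻¹' J₂ := by simpa using h₂.zero_mem
  have d₁ : ∀ f : A, ∀ s ∈ J₁, HasDerivWithinAt (fun s => (f : M → ℝ) (c s))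
      ((X f : M → ℝ) (c s)) J₁ s := fun f s hs => (h₁.congr e₁).hasDeriv f s hs
  have d₂ : ∀ f : A, ∀ s ∈ (fun s => s - t) ⁻¹' J₂, HasDerivWithinAt (fun s => (f : M → ℝ) (c s))
      ((X f : M → ℝ) (c s)) ((fun s => s - t) ⁻¹' J₂) s := fun f s hs => by
    have h1 := h₂.hasDeriv f (s - t) hs
    have h2 : HasDerivWithinAt (fun s : ℝ => s - t) 1 ((fun s => s - t) ⁻¹' J₂) s :=
      (hasDerivWithinAt_id s _).sub_const t
    have h3 := HasDerivWithinAt.scomp s h1 h2 (mapsTo_preimage _ _)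
    rw [e₂ s hs]
    refine HasDerivWithinAt.congr (by simpa [Function.comp_def] using h3) (fun y hy => ?_) ?_
    · rw [e₂ y hy]
    · rw [e₂ s hs]
  refine ⟨c, ⟨ordConnected_union h₁.ordConnected o₂ ht t₂, Or.inl h₁.zero_mem,
    (e₁ h₁.zero_mem).trans h₁.map_zero, fun f s hs => ?_⟩, e₁, e₂⟩
  by_cases hs₁ : s ∈ J₁
  · by_cases hs₂ : s ∈ (fun s => s - t) ⁻¹' J₂
    · exact (d₁ f s hs₁).union (d₂ f s hs₂)
    · exact (d₁ f s hs₁).union ((d₁ f s hs₁).mono_of_mem_nhdsWithin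
        (eventually_mem_of_ordConnected h₁.ordConnected o₂ ht t₂ hs₁ hs₂))
  · have hs₂ := hs.resolve_left hs₁
    exact ((d₂ f s hs₂).mono_of_mem_nhdsWithin
        (eventually_mem_of_ordConnected o₂ h₁.ordConnected t₂ ht hs₂ hs₁)).union (d₂ f s hs₂)

lemma IsIntegralCurve.mem_expDomain (h : IsIntegralCurve X x c J) (ht : t ∈ J) :
    x ∈ expDomain X t := ⟨c, J, h, ht⟩

end Curves

/-! ### Uniqueness of curves when smooth functions determine the topology -/

section Topological

variable {M : Type*} [τM : TopologicalSpace M] {A : Subalgebra ℝ (M → ℝ)}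

lemma IsDifferentialStructure.continuousOn_of_forall (hA : IsDifferentialStructure A)
    {Y : Type*} [TopologicalSpace Y] {φ : Y → M} {s : Set Y}
    (h : ∀ f ∈ A, ContinuousOn (fun y => f (φ y)) s) : ContinuousOn φ s := by
  rw [continuousOn_iff_continuous_domRestrict]
  have : @Continuous s M _ (TopologicalSpace.generateFrom
      {U | ∃ f ∈ A, ∃ a b : ℝ, U = f ⁻¹' Ioo a b}) (s.domRestrict φ) := by
    rw [continuous_generateFrom_iff]
    rintro _ ⟨f, hf, a, b, rfl⟩
    exact (continuousOn_iff_continuous_domRestrict.1 (h f hf)).isOpen_preimage _ isOpen_Ioo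
  rwa [← hA.subbasis] at this

/-- The topology is generated by the smooth functions, so points with equal values have equal
neighbourhood filters. -/
lemma IsDifferentialStructure.eq_of_forall [T2Space M] (hA : IsDifferentialStructure A)
    {x y : M} (h : ∀ f ∈ A, f x = f y) : x = y := by
  apply T0Space.t0
  have hs := hA.subbasis
  rw [TopologicalSpace.ext_iff_nhds] at hs
  have : ∀ z w : M, (∀ f ∈ A, f z = f w) → 𝓝 z ≤ 𝓝 w := by
    intro z w h
    rw [hs w, TopologicalSpace.nhds_generateFrom]
    refine le_iInf₂ fun U hU => ?_
    obtain ⟨hw, f, hf, a, b, rfl⟩ := hU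
    rw [le_principal_iff]
    refine (isOpen_Ioo.preimage (hA.continuous f hf)).mem_nhds ?_
    simpa [h f hf] using hw
  exact le_antisymm (this x y h) (this y x fun f hf => (h f hf).symm)

variable {X : Derivation ℝ A A} {x : M} {c c₁ c₂ : ℝ → M} {J J₁ J₂ : Set ℝ} {t : ℝ}

lemma IsIntegralCurve.continuousOn (hA : IsDifferentialStructure A)
    (h : IsIntegralCurve X x c J) : ContinuousOn c J :=
  hA.continuousOn_of_forall fun f hf t ht => (h.hasDeriv ⟨f, hf⟩ t ht).continuousWithinAt

/-- Two integral curves of `X` through the same point agree near the parameter `0`. -/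
def LocallyUniqueCurves (X : Derivation ℝ A A) : Prop :=
  ∀ (x : M) (c₁ c₂ : ℝ → M) (J₁ J₂ : Set ℝ), IsIntegralCurve X x c₁ J₁ →
    IsIntegralCurve X x c₂ J₂ → ∃ δ > 0, ∀ t ∈ J₁ ∩ J₂, |t| < δ → c₁ t = c₂ t

/-- The set of agreement is clopen in the interval `J₁ ∩ J₂`: closed since `M` is Hausdorff, open by
applying local uniqueness to the curves restarted at a common value. -/
lemma LocallyUniqueCurves.eqOn [T2Space M] (hA : IsDifferentialStructure A)
    (hX : LocallyUniqueCurves X) (h₁ : IsIntegralCurve X x c₁ J₁)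
    (h₂ : IsIntegralCurve X x c₂ J₂) : EqOn c₁ c₂ (J₁ ∩ J₂) := by
  have ho : (J₁ ∩ J₂).OrdConnected := h₁.ordConnected.inter h₂.ordConnected
  have : PreconnectedSpace ↥(J₁ ∩ J₂) := Subtype.preconnectedSpace ho.isPreconnected
  have k₁ := ((h₁.continuousOn hA).mono (inter_subset_left (t := J₂))).domRestrict
  have k₂ := ((h₂.continuousOn hA).mono (inter_subset_right (s := J₁))).domRestrict
  have hclosed := isClosed_eq k₁ k₂
  have hopen : IsOpen {y : ↥(J₁ ∩ J₂) |
      (J₁ ∩ J₂).domRestrict c₁ y = (J₁ ∩ J₂).domRestrict c₂ y} := by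
    rw [Metric.isOpen_iff]
    rintro ⟨t, ht⟩ hte
    have hte : c₁ t = c₂ t := hte
    have k := h₂.shift ht.2
    rw [← hte] at k
    obtain ⟨δ, hδ, H⟩ := hX _ _ _ _ _ (h₁.shift ht.1) k
    refine ⟨δ, hδ, fun s hs => ?_⟩
    have := H (s - t) ⟨by simpa using s.2.1, by simpa using s.2.2⟩ (by
      simpa [Metric.mem_ball, Subtype.dist_eq, Real.dist_eq] using hs)
    change c₁ s = c₂ s
    simpa using this
  have huniv := IsClopen.eq_univ ⟨hclosed, hopen⟩
    ⟨⟨0, h₁.zero_mem, h₂.zero_mem⟩, by simp [h₁.map_zero, h₂.map_zero]⟩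
  intro t ht
  have : (⟨t, ht⟩ : ↥(J₁ ∩ J₂)) ∈ (univ : Set ↥(J₁ ∩ J₂)) := mem_univ _
  rw [← huniv] at this
  exact this

lemma IsIntegralCurve.exp_eq [T2Space M] (hA : IsDifferentialStructure A)
    (hX : LocallyUniqueCurves X) (h : IsIntegralCurve X x c J) (ht : t ∈ J) :
    exp X t x = c t := by
  have hex : ∃ (c : ℝ → M) (J : Set ℝ), IsIntegralCurve X x c J ∧ t ∈ J := ⟨c, J, h, ht⟩
  rw [exp, dif_pos hex]
  obtain ⟨J', hJ', ht'⟩ := hex.choose_spec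
  exact hX.eqOn hA hJ' h ⟨ht', ht⟩

/-- A local flow of `X` on the open set `U` for times of absolute value less than `ε`. -/
structure FlowBox (X : Derivation ℝ A A) (U : Set M) (ε : ℝ) (Φ : ℝ → M → M) : Prop where
  isOpen : IsOpen U
  pos : 0 < ε
  curve : ∀ y ∈ U, IsIntegralCurve X y (fun t => Φ t y) (Ioo (-ε) ε)
  cont : ContinuousOn (fun z : ℝ × M => Φ z.1 z.2) (Ioo (-ε) ε ×ˢ U)
  smooth : ∀ t ∈ Ioo (-ε) ε, SmoothOn A (Φ t) U
  group : ∀ y ∈ U, ∀ r ∈ Ioo (-ε) ε, Φ r y ∈ U → ∀ s ∈ Ioo (-ε) ε, s + r ∈ Ioo (-ε) ε →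
    Φ (s + r) y = Φ s (Φ r y)

end Topological

end DiffSpace

/-! ### From flow boxes to vector fields -/

namespace DiffSpace

open Set Filter

/-- The derivative along the diagonal of a function of two real variables. -/
lemma hasDerivWithinAt_diag {u v : ℝ → ℝ → ℝ} {J : Set ℝ} {t b : ℝ} (hJ : J.OrdConnected)
    (ht : t ∈ J) (h₁ : ∀ s ∈ J, ∀ r ∈ J, HasDerivWithinAt (fun s => u s r) (v s r) J s)
    (hv : ContinuousWithinAt (fun z : ℝ × ℝ => v z.1 z.2) (J ×ˢ J) (t, t))
    (h₂ : HasDerivWithinAt (u t) b J t) :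
    HasDerivWithinAt (fun s => u s s) (v t t + b) J t := by
  -- The mean value inequality in the first variable alone bounds `u r r - u t r - (r - t) v t t`;
  -- the second variable enters only through `u t`.
  have key : HasDerivWithinAt (fun s => u s s - u t s) (v t t) J t := by
    rw [hasDerivWithinAt_iff_isLittleO, Asymptotics.isLittleO_iff]
    intro ε hε
    obtain ⟨δ, hδ, H⟩ := Metric.continuousWithinAt_iff.1 hv ε hε
    filter_upwards [inter_mem_nhdsWithin J (Metric.ball_mem_nhds t hδ)] with r hr
    have hsub : uIcc t r ⊆ J := hJ.uIcc_subset ht hr.1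
    have := Convex.norm_image_sub_le_of_norm_hasDerivWithin_le (s := uIcc t r)
      (f := fun s => u s r - s * v t t) (f' := fun s => v s r - v t t) (C := ε) (x := t) (y := r)
      (fun s hs => by
        have := ((h₁ s (hsub hs) r hr.1).mono hsub).sub
          ((hasDerivWithinAt_id s (uIcc t r)).mul_const (v t t))
        rw [one_mul] at this
        exact this)
      (fun s hs => by
        have hs' : dist s t < δ := by
          refine lt_of_le_of_lt ?_ hr.2
          rw [Real.dist_eq, Real.dist_eq]
          exact abs_sub_left_of_mem_uIcc hs
        have := H (x := (s, r)) ⟨hsub hs, hr.1⟩ (by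
          rw [Prod.dist_eq]; exact max_lt hs' hr.2)
        exact le_of_lt (by simpa [dist_eq_norm] using this))
      (convex_uIcc t r) left_mem_uIcc right_mem_uIcc
    convert this using 2
    simp only [smul_eq_mul]
    ring
  have := key.add h₂
  refine this.congr (fun s _ => ?_) ?_ <;> simp

section

variable {M : Type*} [TopologicalSpace M] [T2Space M] {A : Subalgebra ℝ (M → ℝ)}
  {X : Derivation ℝ A A} {x : M} {c : ℝ → M} {J : Set ℝ} {t s : ℝ}
  {U : Set M} {ε : ℝ} {Φ : ℝ → M → M}

omit [T2Space M] in
lemma FlowBox.zero_mem (h : FlowBox X U ε Φ) : (0 : ℝ) ∈ Ioo (-ε) ε := by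
  simpa using h.pos

omit [T2Space M] in
-- A derivation commutes with its own flow: by the group law `f (Φ (s + r) y) = g (Φ r y)` for small
-- `r`, and the two sides are differentiated at `r = 0`.
lemma FlowBox.deriv_comm (hA : IsDifferentialStructure A) (h : FlowBox X U ε Φ) {y : M}
    (hy : y ∈ U) (hs : s ∈ Ioo (-ε) ε) {f g : A} {V : Set M} (hV : IsOpen V) (hyV : y ∈ V)
    (hfg : ∀ z ∈ V ∩ U, (f : M → ℝ) (Φ s z) = (g : M → ℝ) z) :
    (X g : M → ℝ) y = (X f : M → ℝ) (Φ s y) := by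
  have h0 := h.zero_mem
  have hy0 : Φ 0 y = y := (h.curve y hy).map_zero
  have hI : Ioo (-ε) ε ∈ 𝓝 (0 : ℝ) := Ioo_mem_nhds h0.1 h0.2
  have hc : ContinuousAt (fun r => Φ r y) 0 :=
    ((h.curve y hy).continuousOn hA).continuousAt hI
  have d₁ : HasDerivAt (fun r => (g : M → ℝ) (Φ r y)) ((X g : M → ℝ) y) 0 := by
    have := ((h.curve y hy).hasDeriv g 0 h0).hasDerivAt hI
    simpa only [hy0] using this
  have d₂ : HasDerivAt (fun r => (f : M → ℝ) (Φ (s + r) y)) ((X f : M → ℝ) (Φ s y)) 0 := by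
    have := ((h.curve y hy).hasDeriv f s hs).hasDerivAt (Ioo_mem_nhds hs.1 hs.2)
    rw [← add_zero s] at this
    simpa using this.comp_const_add s 0
  refine d₁.unique (d₂.congr_of_eventuallyEq ?_)
  have e₁ : ∀ᶠ r in 𝓝 (0 : ℝ), Φ r y ∈ V ∩ U := by
    refine hc.eventually_mem ?_
    rw [hy0]
    exact (hV.inter h.isOpen).mem_nhds ⟨hyV, hy⟩
  have e₂ : ∀ᶠ r in 𝓝 (0 : ℝ), s + r ∈ Ioo (-ε) ε := by
    have : ContinuousAt (fun r : ℝ => s + r) 0 := by fun_prop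
    exact this.eventually_mem (Ioo_mem_nhds (by simpa using hs.1) (by simpa using hs.2))
  filter_upwards [e₁, e₂, hI] with r hr₁ hr₂ hr₃
  rw [← hfg _ hr₁, h.group y hy r hr₃ hr₁.2 s hs hr₂]

/-- Flow back along the curve: `f (Φ (-s) (c s))` has derivative zero for every smooth `f`, so `Φ
(-t) (c t) = x`, and applying `Φ t` gives the result. -/
lemma FlowBox.curve_eq (hA : IsDifferentialStructure A) (h : FlowBox X U ε Φ) (hx : x ∈ U)
    (hc : IsIntegralCurve X x c J) : ∃ δ > 0, ∀ t ∈ J, |t| < δ → c t = Φ t x := by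
  have hc0 : ContinuousWithinAt c J 0 := hc.continuousOn hA 0 hc.zero_mem
  have hU : ∀ᶠ t in 𝓝[J] (0 : ℝ), c t ∈ U :=
    hc0.eventually_mem (by rw [hc.map_zero]; exact h.isOpen.mem_nhds hx)
  obtain ⟨δ', hδ', H⟩ := Metric.mem_nhdsWithin_iff.1 hU
  have hδ : 0 < min δ' ε := lt_min hδ' h.pos
  set δ := min δ' ε with hδdef
  set J' := J ∩ Ioo (-δ) δ with hJ'
  have hJo : J'.OrdConnected := hc.ordConnected.inter ordConnected_Ioo
  have hJU : ∀ t ∈ J', c t ∈ U := fun t ht => H ⟨by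
    rw [Metric.mem_ball, Real.dist_eq, sub_zero]
    exact lt_of_lt_of_le (abs_lt.2 ht.2) (min_le_left _ _), ht.1⟩
  have hJε : ∀ t ∈ J', -t ∈ Ioo (-ε) ε := fun t ht =>
    ⟨neg_lt_neg (lt_of_lt_of_le ht.2.2 (min_le_right _ _)),
      by have := ht.2.1; have := min_le_right δ' ε; linarith⟩
  have h0 : (0 : ℝ) ∈ J' := ⟨hc.zero_mem, by simpa using hδ⟩
  have hcJ := (hc.continuousOn hA).mono (inter_subset_left : J' ⊆ J)
  refine ⟨δ, hδ, fun t htJ htδ => ?_⟩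
  have ht : t ∈ J' := ⟨htJ, abs_lt.1 htδ⟩
  have key : Φ (-t) (c t) = x := by
    refine hA.eq_of_forall fun f hf => ?_
    have hd : ∀ s ∈ J', HasDerivWithinAt (fun s => f (Φ (-s) (c s))) 0 J' s := by
      intro s hs
      obtain ⟨V, hV, hyV, g, hg, hfg⟩ := h.smooth (-s) (hJε s hs) f hf (c s) (hJU s hs)
      have hcomm := h.deriv_comm hA (hJU s hs) (hJε s hs) (f := ⟨f, hf⟩) (g := ⟨g, hg⟩) hV hyV hfg
      have d₂ : HasDerivWithinAt (fun r => f (Φ (-s) (c r)))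
          ((X ⟨f, hf⟩ : M → ℝ) (Φ (-s) (c s))) J' s := by
        rw [← hcomm]
        refine ((hc.hasDeriv ⟨g, hg⟩ s hs.1).mono inter_subset_left).congr_of_eventuallyEq ?_
          (hfg _ ⟨hyV, hJU s hs⟩)
        filter_upwards [(hcJ s hs).eventually_mem (hV.mem_nhds hyV), self_mem_nhdsWithin]
          with r hr hr'
        exact hfg _ ⟨hr, hJU r hr'⟩
      -- The time of the box contributes `-(X f)`, the motion of `c` contributes `+(X f)` by
      -- `deriv_comm`, both at `Φ (-s) (c s)`.
      have := hasDerivWithinAt_diag (u := fun s r => f (Φ (-s) (c r)))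
        (v := fun s r => -((X ⟨f, hf⟩ : M → ℝ) (Φ (-s) (c r)))) hJo hs (fun a ha b hb => ?_) ?_ d₂
      · simpa using this
      · have := ((h.curve (c b) (hJU b hb)).hasDeriv ⟨f, hf⟩ (-a) (hJε a ha)).scomp a
          (hasDerivAt_neg a).hasDerivWithinAt (fun r hr => hJε r hr)
        simpa [Function.comp_def] using this
      · have h1 : ContinuousOn (fun z : ℝ × ℝ => Φ (-z.1) (c z.2)) (J' ×ˢ J') := by
          refine h.cont.comp (f := fun z : ℝ × ℝ => (-z.1, c z.2)) ?_ ?_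
          · exact (continuous_fst.neg.continuousOn).prodMk
              (hcJ.comp continuousOn_snd fun z hz => hz.2)
          · exact fun z hz => ⟨hJε _ hz.1, hJU _ hz.2⟩
        exact (((hA.continuous _ (X ⟨f, hf⟩).2).comp_continuousOn h1).neg) (s, s) ⟨hs, hs⟩
    have := Convex.norm_image_sub_le_of_norm_hasDerivWithin_le (C := 0) hd (by simp) hJo.convex
      h0 ht
    have hx0 : Φ 0 x = x := (h.curve x hx).map_zero
    simpa [sub_eq_zero, hc.map_zero, hx0] using this
  have hct := hJU t ht
  have hg := h.group (c t) hct (-t) (hJε t ht) (by rwa [key]) t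
    (by simpa using (show - -t ∈ Ioo (-ε) ε from ⟨neg_lt_neg (hJε t ht).2, by
      have := (hJε t ht).1; linarith⟩)) (by simpa using h.pos)
  rw [key, add_neg_cancel, (h.curve _ hct).map_zero] at hg
  exact hg

/-- Every point has a flow box of `X` around it. -/
def HasFlowBoxes (X : Derivation ℝ A A) : Prop :=
  ∀ x, ∃ (U : Set M) (ε : ℝ) (Φ : ℝ → M → M), x ∈ U ∧ FlowBox X U ε Φ

lemma HasFlowBoxes.locallyUniqueCurves (hA : IsDifferentialStructure A) (hX : HasFlowBoxes X) :
    LocallyUniqueCurves X := by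
  intro x c₁ c₂ J₁ J₂ h₁ h₂
  obtain ⟨U, ε, Φ, hx, h⟩ := hX x
  obtain ⟨δ₁, hδ₁, H₁⟩ := h.curve_eq hA hx h₁
  obtain ⟨δ₂, hδ₂, H₂⟩ := h.curve_eq hA hx h₂
  refine ⟨min δ₁ δ₂, lt_min hδ₁ hδ₂, fun t ht h => ?_⟩
  rw [H₁ t ht.1 (h.trans_le (min_le_left _ _)), H₂ t ht.2 (h.trans_le (min_le_right _ _))]

variable (X x) in
/-- The parameters for which the integral curve of `X` through `x` is defined. -/
def expTimes : Set ℝ := {t | x ∈ expDomain X t}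

/-- Attaching the flow box at `c₁ t` prolongs any curve beyond `t`, so the times form an open set
and the derivative at `t` can be read off one curve defined around `t`. -/
lemma HasFlowBoxes.isIntegralCurve_exp (hA : IsDifferentialStructure A) (hX : HasFlowBoxes X)
    (x : M) : IsOpen (expTimes X x) ∧
      IsIntegralCurve X x (fun t => exp X t x) (expTimes X x) := by
  have hL := hX.locallyUniqueCurves hA
  have key : ∀ t ∈ expTimes X x, ∃ (c : ℝ → M) (J : Set ℝ), J ∈ 𝓝 t ∧
      IsIntegralCurve X x c J := by
    rintro t ⟨c₁, J₁, h₁, ht₁⟩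
    obtain ⟨U, ε, Φ, hU, h⟩ := hX (c₁ t)
    have h₂ := h.curve _ hU
    obtain ⟨c, hc, -, -⟩ := h₁.glue ht₁ h₂ (fun s hs hs' => by
      have := hL.eqOn hA (h₁.shift ht₁) h₂ ⟨by simpa using hs, hs'⟩
      simpa using this)
    refine ⟨c, _, ?_, hc⟩
    refine mem_of_superset (Ioo_mem_nhds (sub_lt_self t h.pos) (lt_add_of_pos_right t h.pos)) ?_
    intro s hs
    exact Or.inr ⟨by linarith [hs.1], by linarith [hs.2]⟩
  have hsub : ∀ (c : ℝ → M) (J : Set ℝ), IsIntegralCurve X x c J → J ⊆ expTimes X x :=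
    fun c J h t ht => h.mem_expDomain ht
  obtain ⟨U, ε, Φ, hU, hb⟩ := hX x
  refine ⟨isOpen_iff_mem_nhds.2 fun t ht => ?_, ⟨⟨?_⟩, hsub _ _ (hb.curve x hU) hb.zero_mem, ?_, ?_⟩⟩
  · obtain ⟨c, J, hJ, h⟩ := key t ht
    exact mem_of_superset hJ (hsub c J h)
  · rintro a ⟨c, J, h, ha⟩ b ⟨c', J', h', hb⟩ z hz
    rcases le_total 0 z with h0 | h0
    · exact hsub _ _ h' (h'.ordConnected.out h'.zero_mem hb ⟨h0, hz.2⟩)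
    · exact hsub _ _ h (h.ordConnected.out ha h.zero_mem ⟨hz.1, h0⟩)
  · exact ((hb.curve x hU).exp_eq hA hL hb.zero_mem).trans (hb.curve x hU).map_zero
  · intro f t ht
    obtain ⟨c, J, hJ, h⟩ := key t ht
    have hd := (h.congr (fun s hs => h.exp_eq hA hL hs)).hasDeriv f t (mem_of_mem_nhds hJ)
    exact (hd.hasDerivAt hJ).hasDerivWithinAt

lemma HasFlowBoxes.exp_add (hA : IsDifferentialStructure A) (hX : HasFlowBoxes X)
    (ht : x ∈ expDomain X t) (hs : exp X t x ∈ expDomain X s) :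
    x ∈ expDomain X (s + t) ∧ exp X (s + t) x = exp X s (exp X t x) := by
  have hL := hX.locallyUniqueCurves hA
  have h₁ := (hX.isIntegralCurve_exp hA x).2
  have h₂ := (hX.isIntegralCurve_exp hA (exp X t x)).2
  have ht : t ∈ expTimes X x := ht
  have hs : s ∈ expTimes X (exp X t x) := hs
  obtain ⟨c, hc, -, e⟩ := h₁.glue ht h₂ (fun r hr hr' => by
    have := hL.eqOn hA (h₁.shift ht) h₂ ⟨by simpa using hr, hr'⟩
    simpa using this)
  have hm : s + t ∈ expTimes X x ∪ (fun r => r - t) ⁻¹' expTimes X (exp X t x) :=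
    Or.inr (by simpa using hs)
  refine ⟨hc.mem_expDomain hm, ?_⟩
  rw [hc.exp_eq hA hL hm, e _ (by simpa using hs)]
  simp

lemma HasFlowBoxes.exp_zero (hA : IsDifferentialStructure A) (hX : HasFlowBoxes X) (x : M) :
    x ∈ expDomain X 0 ∧ exp X 0 x = x := by
  have h := (hX.isIntegralCurve_exp hA x).2
  exact ⟨h.zero_mem, h.map_zero⟩

lemma HasFlowBoxes.exp_neg (hA : IsDifferentialStructure A) (hX : HasFlowBoxes X)
    (ht : x ∈ expDomain X t) : exp X t x ∈ expDomain X (-t) ∧ exp X (-t) (exp X t x) = x := by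
  have h := (hX.isIntegralCurve_exp hA x).2
  have hm : exp X t x ∈ expDomain X (-t) :=
    (h.shift (t := t) ht).mem_expDomain (by simpa using h.zero_mem)
  refine ⟨hm, ?_⟩
  rw [← (hX.exp_add hA ht hm).2, neg_add_cancel, (hX.exp_zero hA x).2]

omit [T2Space M] in
lemma SmoothOn.mono {φ : M → M} {V : Set M} (h : SmoothOn A φ U) (hV : V ⊆ U) :
    SmoothOn A φ V := by
  intro f hf x hx
  obtain ⟨W, hW, hxW, g, hg, e⟩ := h f hf x (hV hx)
  exact ⟨W, hW, hxW, g, hg, fun y hy => e y ⟨hy.1, hV hy.2⟩⟩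

omit [T2Space M] in
lemma SmoothOn.congr {φ ψ : M → M} (h : SmoothOn A φ U) (he : EqOn ψ φ U) :
    SmoothOn A ψ U := by
  intro f hf x hx
  obtain ⟨W, hW, hxW, g, hg, e⟩ := h f hf x hx
  exact ⟨W, hW, hxW, g, hg, fun y hy => by rw [he hy.2, e y hy]⟩

omit [T2Space M] in
lemma SmoothOn.comp {φ ψ : M → M} {V : Set M} (hU : IsOpen U) (hψ : SmoothOn A ψ V)
    (hφ : SmoothOn A φ U) (hc : ContinuousOn φ U) (hm : MapsTo φ U V) :
    SmoothOn A (fun x => ψ (φ x)) U := by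
  intro f hf x hx
  obtain ⟨W, hW, hxW, g, hg, e⟩ := hψ f hf (φ x) (hm hx)
  obtain ⟨W', hW', hxW', g', hg', e'⟩ := hφ g hg x hx
  refine ⟨W' ∩ (U ∩ φ ⁻¹' W), hW'.inter (hc.isOpen_inter_preimage hU hW), ⟨hxW', hx, hxW⟩, g', hg',
    fun y hy => ?_⟩
  rw [e _ ⟨hy.1.2.2, hm hy.2⟩, e' y ⟨hy.1.1, hy.2⟩]

variable (X) in
/-- `exp tX` is defined, continuous and smooth near `x`. -/
def RegularAt (t : ℝ) (x : M) : Prop :=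
  ∃ N : Set M, IsOpen N ∧ x ∈ N ∧ N ⊆ expDomain X t ∧ ContinuousOn (exp X t) N ∧
    SmoothOn A (exp X t) N

lemma FlowBox.exp_eq (hA : IsDifferentialStructure A) (hX : HasFlowBoxes X)
    (h : FlowBox X U ε Φ) (hs : x ∈ expDomain X s) (hU : exp X s x ∈ U)
    (ht : t - s ∈ Ioo (-ε) ε) :
    x ∈ expDomain X t ∧ exp X t x = Φ (t - s) (exp X s x) := by
  have hc := h.curve _ hU
  have := hX.exp_add hA hs (hc.mem_expDomain ht)
  rw [sub_add_cancel] at this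
  exact ⟨this.1, this.2.trans (hc.exp_eq hA (hX.locallyUniqueCurves hA) ht)⟩

/-- Near `x` one has `exp X t = Φ (t - s) ∘ exp X s`, so a flow box at the point reached carries
regularity from time `s` to time `t`, jointly continuously in time. -/
lemma RegularAt.step (hA : IsDifferentialStructure A) (hX : HasFlowBoxes X)
    (h : FlowBox X U ε Φ) (hr : RegularAt X s x) (hU : exp X s x ∈ U)
    (ht : t - s ∈ Ioo (-ε) ε) : RegularAt X t x ∧ ∃ W : Set (ℝ × M), IsOpen W ∧ (t, x) ∈ W ∧
      W ⊆ {z : ℝ × M | z.2 ∈ expDomain X z.1} ∧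
      ContinuousOn (fun z : ℝ × M => exp X z.1 z.2) W := by
  obtain ⟨N, hN, hxN, hNd, hNc, hNs⟩ := hr
  set N' := N ∩ exp X s ⁻¹' U
  have hN' : IsOpen N' := hNc.isOpen_inter_preimage hN h.isOpen
  have hxN' : x ∈ N' := ⟨hxN, hU⟩
  have key : ∀ y ∈ N', ∀ r, r - s ∈ Ioo (-ε) ε →
      y ∈ expDomain X r ∧ exp X r y = Φ (r - s) (exp X s y) :=
    fun y hy r hr => h.exp_eq hA hX (hNd hy.1) hy.2 hr
  have hW : ContinuousOn (fun z : ℝ × M => exp X z.1 z.2)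
      (((fun r => r - s) ⁻¹' Ioo (-ε) ε) ×ˢ N') := by
    have : ContinuousOn (fun z : ℝ × M => Φ (z.1 - s) (exp X s z.2))
        (((fun r => r - s) ⁻¹' Ioo (-ε) ε) ×ˢ N') := by
      refine h.cont.comp (f := fun z : ℝ × M => (z.1 - s, exp X s z.2)) ?_ ?_
      · exact (Continuous.continuousOn (by fun_prop)).prodMk
          ((hNc.mono inter_subset_left).comp continuousOn_snd fun z hz => hz.2)
      · exact fun z hz => ⟨hz.1, hz.2.2⟩
    exact this.congr fun z hz => (key _ hz.2 _ hz.1).2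
  refine ⟨⟨N', hN', hxN', fun y hy => (key y hy t ht).1, ?_, ?_⟩,
    ((fun r => r - s) ⁻¹' Ioo (-ε) ε) ×ˢ N', (isOpen_Ioo.preimage (by fun_prop)).prod hN',
    ⟨ht, hxN'⟩, fun z hz => (key _ hz.2 _ hz.1).1,
    hW⟩
  · exact hW.comp (f := fun y => (t, y)) (by fun_prop) fun y hy => ⟨ht, hy⟩
  · refine SmoothOn.congr ?_ fun y hy => (key y hy t ht).2
    exact SmoothOn.comp hN' (h.smooth _ ht) (hNs.mono inter_subset_left)
      (hNc.mono inter_subset_left) fun y hy => hy.2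

/-- The regular times form a clopen set containing `0` in the interval of existence. -/
lemma HasFlowBoxes.regularAt (hA : IsDifferentialStructure A) (hX : HasFlowBoxes X)
    (ht : x ∈ expDomain X t) : RegularAt X t x := by
  obtain ⟨ho, hc⟩ := hX.isIntegralCurve_exp hA x
  have hcont := hc.continuousOn hA
  have hpre : IsPreconnected (expTimes X x) := hc.ordConnected.isPreconnected
  have key : ∀ t ∈ expTimes X x, ∃ V : Set ℝ, IsOpen V ∧ t ∈ V ∧ V ⊆ expTimes X x ∧
      ∀ a ∈ V, ∀ b ∈ V, RegularAt X a x → RegularAt X b x := by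
    intro t ht
    obtain ⟨U, ε, Φ, hU, h⟩ := hX (exp X t x)
    -- Half the width of the box: any two times in this set differ by less than `ε`, and at both the
    -- curve is in `U`. Regularity thus passes either way, which gives openness and closedness
    -- together.
    refine ⟨(expTimes X x ∩ (fun t => exp X t x) ⁻¹' U) ∩ Ioo (t - ε / 2) (t + ε / 2),
      (hcont.isOpen_inter_preimage ho h.isOpen).inter isOpen_Ioo,
      ⟨⟨ht, hU⟩, by linarith [h.pos], by linarith [h.pos]⟩, fun s hs => hs.1.1, ?_⟩
    intro a ha b hb hr
    refine (RegularAt.step hA hX h hr ha.1.2 ⟨?_, ?_⟩).1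
    · linarith [ha.2.2, hb.2.1]
    · linarith [ha.2.1, hb.2.2]
  have : PreconnectedSpace (expTimes X x) := Subtype.preconnectedSpace hpre
  have hclopen : IsClopen {s : expTimes X x | RegularAt X s x} := by
    constructor
    · rw [← isOpen_compl_iff, isOpen_iff_mem_nhds]
      intro s hs
      obtain ⟨V, hV, hsV, -, H⟩ := key s s.2
      filter_upwards [(hV.preimage continuous_subtype_val).mem_nhds hsV] with r hr hr'
      exact hs (H _ hr _ hsV hr')
    · rw [isOpen_iff_mem_nhds]
      intro s hs
      obtain ⟨V, hV, hsV, -, H⟩ := key s s.2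
      filter_upwards [(hV.preimage continuous_subtype_val).mem_nhds hsV] with r hr
      exact H _ hsV _ hr hs
  have h0 : RegularAt X 0 x := by
    have hz := hX.exp_zero hA (X := X)
    have hid : exp X 0 = id := funext fun y => (hz y).2
    refine ⟨univ, isOpen_univ, mem_univ _, fun y _ => (hz y).1, ?_, ?_⟩
    · rw [hid]; exact continuousOn_id
    · rw [hid]; exact fun f hf y _ => ⟨univ, isOpen_univ, mem_univ _, f, hf, fun z _ => rfl⟩
  have huniv := hclopen.eq_univ ⟨⟨0, hc.zero_mem⟩, h0⟩
  have : (⟨t, ht⟩ : expTimes X x) ∈ (univ : Set (expTimes X x)) := mem_univ _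
  rw [← huniv] at this
  exact this

lemma HasFlowBoxes.isOpen_expDomain (hA : IsDifferentialStructure A) (hX : HasFlowBoxes X)
    (t : ℝ) : IsOpen (expDomain X t) := by
  refine isOpen_iff_forall_mem_open.2 fun x hx => ?_
  obtain ⟨N, hN, hxN, hNd, -, -⟩ := hX.regularAt hA hx
  exact ⟨N, hNd, hN, hxN⟩

lemma HasFlowBoxes.continuousOn_expDomain (hA : IsDifferentialStructure A) (hX : HasFlowBoxes X)
    (t : ℝ) : ContinuousOn (exp X t) (expDomain X t) := by
  intro x hx
  obtain ⟨N, hN, hxN, -, hNc, -⟩ := hX.regularAt hA hx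
  exact (hNc.continuousAt (hN.mem_nhds hxN)).continuousWithinAt

lemma HasFlowBoxes.smoothOn_expDomain (hA : IsDifferentialStructure A) (hX : HasFlowBoxes X)
    (t : ℝ) : SmoothOn A (exp X t) (expDomain X t) := by
  intro f hf x hx
  obtain ⟨N, hN, hxN, hNd, -, hNs⟩ := hX.regularAt hA hx
  obtain ⟨V, hV, hxV, g, hg, e⟩ := hNs f hf x hxN
  exact ⟨V ∩ N, hV.inter hN, ⟨hxV, hxN⟩, g, hg, fun y hy => e y hy.1⟩

/-- A derivation with a flow box around each point is a vector field. -/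
theorem HasFlowBoxes.isVectorField (hA : IsDifferentialStructure A) (hX : HasFlowBoxes X) :
    IsVectorField X := by
  have hL := hX.locallyUniqueCurves hA
  have hjoint : ∀ z : ℝ × M, z.2 ∈ expDomain X z.1 → ∃ W : Set (ℝ × M), IsOpen W ∧ z ∈ W ∧
      W ⊆ {z : ℝ × M | z.2 ∈ expDomain X z.1} ∧
      ContinuousOn (fun z : ℝ × M => exp X z.1 z.2) W := by
    rintro ⟨t, x⟩ hz
    obtain ⟨U, ε, Φ, hU, h⟩ := hX (exp X t x)
    exact (RegularAt.step hA hX h (hX.regularAt hA hz) hU (by simpa using h.pos)).2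
  refine ⟨fun x => ?_, ?_, ?_, hX.exp_zero hA, fun s t x ht hs => hX.exp_add hA ht hs, fun t => ?_⟩
  · exact ⟨_, _, (hX.isIntegralCurve_exp hA x).2, fun c' J' h' =>
      ⟨fun t ht => h'.mem_expDomain ht, fun t ht => (h'.exp_eq hA hL ht).symm⟩⟩
  · refine isOpen_iff_forall_mem_open.2 fun z hz => ?_
    obtain ⟨W, hW, hzW, hWd, -⟩ := hjoint z hz
    exact ⟨W, hWd, hW, hzW⟩
  · intro z hz
    obtain ⟨W, hW, hzW, -, hWc⟩ := hjoint z hz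
    exact (hWc.continuousAt (hW.mem_nhds hzW)).continuousWithinAt
  · have hneg : ∀ y ∈ expDomain X (-t), exp X (-t) y ∈ expDomain X t ∧
        exp X t (exp X (-t) y) = y := fun y hy => by simpa using hX.exp_neg hA hy
    exact ⟨hX.isOpen_expDomain hA t, hX.isOpen_expDomain hA (-t), exp X (-t),
      fun y hy => (hX.exp_neg hA hy).1, fun y hy => (hneg y hy).1,
      ⟨fun y hy => (hX.exp_neg hA hy).2, fun y hy => (hneg y hy).2⟩,
      hX.continuousOn_expDomain hA t, hX.continuousOn_expDomain hA (-t),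
      hX.smoothOn_expDomain hA t, hX.smoothOn_expDomain hA (-t)⟩

end

end DiffSpace

/-! ### Smooth flows in Banach spaces through the implicit function theorem -/

namespace SmoothFlow

open Set Filter

universe u

section Superposition

variable {K : Type*} [TopologicalSpace K] [CompactSpace K]
  {E F : Type u} [NormedAddCommGroup E] [NormedSpace ℝ E] [NormedAddCommGroup F] [NormedSpace ℝ F]

/-- Pointwise application of a continuous family of linear maps, as a bilinear map. -/
noncomputable def pointwiseApply : C(K, E →L[ℝ] F) →L[ℝ] C(K, E) →L[ℝ] C(K, F) :=
  LinearMap.mkContinuous₂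
    (LinearMap.mk₂ ℝ (fun (A : C(K, E →L[ℝ] F)) (v : C(K, E)) =>
        (⟨fun k => A k (v k), by fun_prop⟩ : C(K, F)))
      (fun A B v => by ext; simp) (fun a A v => by ext; simp)
      (fun A v w => by ext; simp) (fun a A v => by ext; simp)) 1 (fun A v => by
    rw [one_mul, ContinuousMap.norm_le _ (mul_nonneg (norm_nonneg A) (norm_nonneg v))]
    intro k
    exact ((A k).le_opNorm _).trans (mul_le_mul (A.norm_coe_le_norm k) (v.norm_coe_le_norm k)
      (norm_nonneg _) (norm_nonneg _)))

@[simp]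
lemma pointwiseApply_apply (A : C(K, E →L[ℝ] F)) (v : C(K, E)) (k : K) :
    pointwiseApply A v k = A k (v k) := rfl

/-- The superposition operator `u ↦ f ∘ u` is differentiable if `f` is continuously
differentiable. -/
lemma hasFDerivAt_superposition {f : C(E, F)} {f' : C(E, E →L[ℝ] F)}
    (hf : ∀ x, HasFDerivAt f (f' x) x) (v : C(K, E)) :
    HasFDerivAt (fun v : C(K, E) => f.comp v) (pointwiseApply (f'.comp v)) v := by
  rw [hasFDerivAt_iff_isLittleO_nhds_zero, Asymptotics.isLittleO_iff]
  intro ε hε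
  have hc : Continuous (fun v : C(K, E) => f'.comp v) := ContinuousMap.continuous_postcomp f'
  obtain ⟨δ, hδ, H⟩ := (Metric.continuousAt_iff (α := C(K, E)) (β := C(K, E →L[ℝ] F))).1
    (hc.continuousAt (x := v)) ε hε
  filter_upwards [Metric.ball_mem_nhds (0 : C(K, E)) hδ] with h hh
  rw [mem_ball_zero_iff] at hh
  rw [ContinuousMap.norm_le _ (by positivity)]
  intro k
  have hseg : ∀ z ∈ Metric.closedBall (v k) ‖h‖, ‖f' z - f' (v k)‖ ≤ ε := by
    intro z hz
    rw [mem_closedBall_iff_norm] at hz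
    -- Shifting `v` by a constant curve makes it pass through `z` at `k`. Continuity of `v ↦ f' ∘ v`
    -- in the sup norm then serves as continuity of `f'` along `v`, uniform in `k`.
    have := H (x := v + ContinuousMap.const K (z - v k)) (by
      rw [dist_eq_norm, add_sub_cancel_left]
      refine lt_of_le_of_lt ((ContinuousMap.norm_le _ (norm_nonneg h)).2 fun _ => ?_) hh
      simpa using hz)
    have h2 := (ContinuousMap.dist_apply_le_dist (f := f'.comp (v + ContinuousMap.const K (z - v k)))
      (g := f'.comp v) k).trans this.le
    simpa [dist_eq_norm] using h2
  have := Convex.norm_image_sub_le_of_norm_hasFDerivWithin_le' (f := f) (f' := f')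
    (φ := f' (v k)) (C := ε) (x := v k) (y := v k + h k)
    (fun z _ => (hf z).hasFDerivWithinAt) hseg (convex_closedBall _ _)
    (Metric.mem_closedBall_self (norm_nonneg _))
    (by rw [mem_closedBall_iff_norm]; simpa using h.norm_coe_le_norm k)
  rw [add_sub_cancel_left] at this
  refine le_trans ?_ (this.trans (mul_le_mul_of_nonneg_left (h.norm_coe_le_norm k) hε.le))
  simp

/-- The derivative is superposition with `fderiv ℝ f` followed by a bounded linear map. The target
`F` varies in the induction because that derivative takes values in `E →L[ℝ] F`. -/
lemma contDiff_superposition_nat (n : ℕ) : ∀ {F : Type u} [NormedAddCommGroup F] [NormedSpace ℝ F]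
    (f : C(E, F)), ContDiff ℝ ∞ f → ContDiff ℝ n (fun v : C(K, E) => f.comp v) := by
  induction n with
  | zero =>
    intro F _ _ f _
    exact contDiff_zero.2 (ContinuousMap.continuous_postcomp f)
  | succ n ih =>
    intro F _ _ f hf
    obtain ⟨hd, hf'⟩ := contDiff_infty_iff_fderiv.1 hf
    let f' : C(E, E →L[ℝ] F) := ⟨fderiv ℝ f, hf'.continuous⟩
    have h := fun v : C(K, E) =>
      hasFDerivAt_superposition (f := f) (f' := f') (fun x => (hd x).hasFDerivAt) v
    push_cast
    refine contDiff_succ_iff_fderiv.2 ⟨fun v => (h v).differentiableAt, by simp, ?_⟩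
    rw [funext fun v => (h v).fderiv]
    exact pointwiseApply.contDiff.comp (ih f' hf')

lemma contDiff_superposition {f : C(E, F)} (hf : ContDiff ℝ ∞ f) :
    ContDiff ℝ ∞ (fun v : C(K, E) => f.comp v) :=
  contDiff_infty.2 fun n => contDiff_superposition_nat n f hf

end Superposition

section Integral

variable {E : Type u} [NormedAddCommGroup E] [NormedSpace ℝ E]

/-- The interval `[-1, 1]`. -/
abbrev UnitInterval : Type := Icc (-1 : ℝ) 1

/-- The extension of a continuous curve on `[-1, 1]` that is constant on both sides. -/
noncomputable def extend (v : C(UnitInterval, E)) (r : ℝ) : E := v (projIcc (-1) 1 (by norm_num) r)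

omit [NormedSpace ℝ E] in
@[fun_prop]
lemma continuous_extend (v : C(UnitInterval, E)) : Continuous (extend v) :=
  v.continuous.comp continuous_projIcc

omit [NormedSpace ℝ E] in
lemma extend_of_mem (v : C(UnitInterval, E)) {r : ℝ} (hr : r ∈ Icc (-1 : ℝ) 1) :
    extend v r = v ⟨r, hr⟩ := by
  rw [extend, projIcc_of_mem]

/-- The primitive that vanishes at `0`, as a continuous linear map. -/
noncomputable def primitive : C(UnitInterval, E) →L[ℝ] C(UnitInterval, E) :=
  LinearMap.mkContinuous
    { toFun := fun v => ⟨fun s => ∫ r in (0 : ℝ)..s, extend v r,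
        (intervalIntegral.continuous_primitive
          (fun a b => (continuous_extend v).intervalIntegrable a b) 0).comp continuous_subtype_val⟩
      map_add' := fun v w => by
        ext s
        exact intervalIntegral.integral_add ((continuous_extend v).intervalIntegrable _ _)
          ((continuous_extend w).intervalIntegrable _ _)
      map_smul' := fun a v => by
        ext s
        exact intervalIntegral.integral_smul a _ } 1 (fun v => by
    rw [one_mul, ContinuousMap.norm_le _ (norm_nonneg v)]
    intro s
    refine (intervalIntegral.norm_integral_le_of_norm_le_const (C := ‖v‖)
      fun r _ => v.norm_coe_le_norm _).trans ?_
    rw [sub_zero]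
    exact mul_le_of_le_one_right (norm_nonneg v) (abs_le.2 s.2))

lemma primitive_apply (v : C(UnitInterval, E)) (s : UnitInterval) :
    primitive v s = ∫ r in (0 : ℝ)..s, extend v r := rfl

/-- Constant curves. -/
noncomputable def constCurve : E →L[ℝ] C(UnitInterval, E) := ContinuousLinearMap.const ℝ _

@[simp]
lemma constCurve_apply (x : E) (s : UnitInterval) : constCurve x s = x := rfl

/-- The zeros of this map are the triples `((τ, x), v)` with `v' = τ f(v)` and `v 0 = x`. -/
noncomputable def flowEquation (f : C(E, E)) (z : (ℝ × E) × C(UnitInterval, E)) :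
    C(UnitInterval, E) :=
  z.2 - constCurve z.1.2 - z.1.1 • primitive (f.comp z.2)

lemma contDiff_flowEquation {f : C(E, E)} (hf : ContDiff ℝ ∞ f) :
    ContDiff ℝ ∞ (flowEquation f) := by
  have h := (primitive (E := E)).contDiff.comp ((contDiff_superposition (K := UnitInterval) hf).comp
    (contDiff_snd (E := ℝ × E) (F := C(UnitInterval, E))))
  exact (contDiff_snd.sub (constCurve.contDiff.comp (contDiff_snd.comp contDiff_fst))).sub
    ((contDiff_fst.comp contDiff_fst).smul h)

lemma flowEquation_eq_zero_iff {f : C(E, E)} {τ : ℝ} {x : E} {v : C(UnitInterval, E)} :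
    flowEquation f ((τ, x), v) = 0 ↔
      ∀ s : UnitInterval, v s = x + τ • ∫ r in (0 : ℝ)..s, f (extend v r) := by
  rw [ContinuousMap.ext_iff]
  refine forall_congr' fun s => ?_
  simp only [flowEquation, ContinuousMap.sub_apply, constCurve_apply, ContinuousMap.smul_apply,
    primitive_apply, ContinuousMap.zero_apply]
  rw [sub_sub, sub_eq_zero]
  rfl

/-- Rescaling of a curve. -/
noncomputable def rescale (σ : UnitInterval) (v : C(UnitInterval, E)) : C(UnitInterval, E) :=
  ⟨fun s => extend v (σ * s), by fun_prop⟩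

lemma mul_mem_unit {a b : ℝ} (ha : a ∈ Icc (-1 : ℝ) 1) (hb : b ∈ Icc (-1 : ℝ) 1) :
    a * b ∈ Icc (-1 : ℝ) 1 := by
  rw [mem_Icc, ← abs_le] at *
  rw [abs_mul]
  exact mul_le_one₀ ha (abs_nonneg b) hb

/-- Slowing a solution down by `σ` multiplies its speed `τ` by `σ`; this lets the parameter `τ` play
the part of time. The interval is symmetric, so `σ` may be negative. -/
lemma flowEquation_rescale {f : C(E, E)} {τ : ℝ} {x : E} {v : C(UnitInterval, E)}
    (h : flowEquation f ((τ, x), v) = 0) (σ : UnitInterval) :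
    flowEquation f ((σ * τ, x), rescale σ v) = 0 := by
  rw [flowEquation_eq_zero_iff] at h ⊢
  intro s
  have h1 : rescale σ v s = v ⟨σ * s, mul_mem_unit σ.2 s.2⟩ := extend_of_mem v _
  rw [h1, h, mul_comm (σ : ℝ) τ, mul_smul]
  congr 2
  have h2 := intervalIntegral.smul_integral_comp_mul_left (a := 0) (b := (s : ℝ))
    (fun r => f (extend v r)) (σ : ℝ)
  rw [mul_zero] at h2
  rw [← h2]
  congr 1
  refine intervalIntegral.integral_congr fun r hr => ?_
  have hr' : r ∈ Icc (-1 : ℝ) 1 :=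
    (ordConnected_Icc.uIcc_subset (by norm_num : (0 : ℝ) ∈ Icc (-1 : ℝ) 1) s.2) hr
  rw [extend_of_mem (rescale σ v) hr']
  rfl

end Integral

section Flow

variable {E : Type u} [NormedAddCommGroup E] [NormedSpace ℝ E] [CompleteSpace E]

/-- `ContDiffAt ℝ ∞` at `a` does not by itself give one neighbourhood on which `ψ` is smooth. The
theorem is therefore applied again at each nearby point, where the partial derivative is still
invertible, and uniqueness identifies the new implicit function with `ψ`. -/
lemma eventually_implicit {E₁ E₂ F : Type*} [NormedAddCommGroup E₁] [NormedSpace ℝ E₁]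
    [CompleteSpace E₁] [NormedAddCommGroup E₂] [NormedSpace ℝ E₂] [CompleteSpace E₂]
    [NormedAddCommGroup F] [NormedSpace ℝ F] [CompleteSpace F] {g : E₁ × E₂ → F}
    (hg : ContDiff ℝ ∞ g) {a : E₁} {b : E₂} (h0 : g (a, b) = 0)
    (hi : (fderiv ℝ g (a, b) ∘L .inr ℝ E₁ E₂).IsInvertible) :
    ∃ ψ : E₁ → E₂, ContinuousAt ψ a ∧ ψ a = b ∧
      (∀ᶠ p in 𝓝 a, ContDiffAt ℝ ∞ ψ p ∧ g (p, ψ p) = 0) ∧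
      ∀ᶠ z in 𝓝 (a, b), g z = 0 → ψ z.1 = z.2 := by
  have hne : (∞ : ℕ∞ω) ≠ 0 := by simp
  have cd : ContDiffAt ℝ ∞ g (a, b) := hg.contDiffAt
  set ψ := cd.implicitFunction hne hi
  have hψ : ContDiffAt ℝ ∞ ψ a := cd.contDiffAt_implicitFunction hne hi
  have hψa : ψ a = b := cd.implicitFunction_apply_self hne hi
  have hz : ∀ᶠ p in 𝓝 a, g (p, ψ p) = 0 := by
    simpa [h0] using cd.eventually_apply_implicitFunction hne hi
  refine ⟨ψ, hψ.continuousAt, hψa, ?_, ?_⟩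
  · have hc1 : ∀ᶠ p in 𝓝 a, ContDiffAt ℝ 1 ψ p :=
      (hψ.of_le (by simp : (1 : ℕ∞ω) ≤ ∞)).eventually (by simp)
    have hinv : ∀ᶠ p in 𝓝 a, (fderiv ℝ g (p, ψ p) ∘L .inr ℝ E₁ E₂).IsInvertible := by
      have hcont : ContinuousAt (fun p => fderiv ℝ g (p, ψ p) ∘L .inr ℝ E₁ E₂) a := by
        have h1 : ContinuousAt (fun p => fderiv ℝ g (p, ψ p)) a :=
          ((hg.continuous_fderiv (by simp)).continuousAt).comp
            (f := fun p => (p, ψ p)) (continuousAt_id.prodMk hψ.continuousAt)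
        exact h1.clm_comp continuousAt_const
      have ho : IsOpen {L : E₂ →L[ℝ] F | L.IsInvertible} :=
        ContinuousLinearEquiv.isOpen (𝕜 := ℝ) (E := E₂) (F := F)
      exact hcont.eventually_mem (ho.mem_nhds (by
        show (fderiv ℝ g (a, ψ a) ∘L .inr ℝ E₁ E₂).IsInvertible
        rw [hψa]; exact hi))
    filter_upwards [hc1, hinv, hz, hz.eventually_nhds] with p h1 h2 h3 h4
    refine ⟨?_, h3⟩
    have cd' : ContDiffAt ℝ ∞ g (p, ψ p) := hg.contDiffAt
    refine (cd'.contDiffAt_implicitFunction hne h2).congr_of_eventuallyEq ?_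
    have hev := cd'.eventually_apply_eq_iff_implicitFunction hne h2
    have hct : ContinuousAt (fun q => (q, ψ q)) p := continuousAt_id.prodMk h1.continuousAt
    filter_upwards [h4, hct.eventually hev] with q hq hq'
    exact (hq'.1 (by rw [hq, h3])).symm
  · filter_upwards [cd.eventually_apply_eq_iff_implicitFunction hne hi] with z hz' hz0
    exact hz'.1 (by rw [hz0, h0])

/-- A smooth vector field on a Banach space has a smooth local flow. -/
theorem exists_smooth_flow {f : E → E} (hf : ContDiff ℝ ∞ f) (x₀ : E) :
    ∃ ε > 0, ∃ φ : ℝ × E → E, ContDiffOn ℝ ∞ φ (Ioo (-ε) ε ×ˢ Metric.ball x₀ ε) ∧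
      ∀ x ∈ Metric.ball x₀ ε, φ (0, x) = x ∧
        ∀ t ∈ Ioo (-ε) ε, HasDerivAt (fun s => φ (s, x)) (f (φ (t, x))) t := by
  let fC : C(E, E) := ⟨f, hf.continuous⟩
  have hg : ContDiff ℝ ∞ (flowEquation fC) := contDiff_flowEquation (f := fC) hf
  have h0 : flowEquation fC (((0 : ℝ), x₀), constCurve x₀) = 0 := by
    rw [flowEquation_eq_zero_iff]; simp
  -- At `τ = 0` the nonlinear term disappears, so the partial derivative in the curve is the
  -- identity.
  have hi : (fderiv ℝ (flowEquation fC) (((0 : ℝ), x₀), constCurve x₀) ∘L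
      .inr ℝ (ℝ × E) C(UnitInterval, E)).IsInvertible := by
    have h1 : HasFDerivAt (fun v => flowEquation fC (((0 : ℝ), x₀), v))
        (fderiv ℝ (flowEquation fC) (((0 : ℝ), x₀), constCurve x₀) ∘L
          .inr ℝ (ℝ × E) C(UnitInterval, E)) (constCurve x₀) :=
      ((hg.differentiable (by simp)) _).hasFDerivAt.comp _ (hasFDerivAt_prodMk_right _ _)
    have h2 : HasFDerivAt (fun v => flowEquation fC (((0 : ℝ), x₀), v))
        (ContinuousLinearMap.id ℝ C(UnitInterval, E)) (constCurve x₀) := by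
      have : (fun v => flowEquation fC (((0 : ℝ), x₀), v)) = fun v => v - constCurve x₀ := by
        funext v; simp [flowEquation]
      rw [this]
      exact (hasFDerivAt_id _).sub_const _
    rw [h1.unique h2]
    exact ⟨ContinuousLinearEquiv.refl ℝ _, rfl⟩
  obtain ⟨ψ, hψc, hψ0, hψ, huniq⟩ := eventually_implicit hg h0 hi
  obtain ⟨r, hr, hru⟩ := Metric.eventually_nhds_iff_ball.1 huniq
  have hclose : ∀ᶠ p in 𝓝 ((0 : ℝ), x₀), ψ p ∈ Metric.ball (constCurve x₀) r :=
    hψc.eventually_mem (by rw [hψ0]; exact Metric.ball_mem_nhds _ hr)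
  obtain ⟨ε', hε', H⟩ := Metric.eventually_nhds_iff_ball.1 (hψ.and hclose)
  set ε := min ε' r
  have hε : 0 < ε := lt_min hε' hr
  have hmem : ∀ t ∈ Ioo (-ε) ε, ∀ x ∈ Metric.ball x₀ ε,
      (t, x) ∈ Metric.ball ((0 : ℝ), x₀) ε := by
    intro t ht x hx
    rw [← ball_prod_same]
    exact ⟨by simpa [abs_lt] using ht, hx⟩
  have H' : ∀ t ∈ Ioo (-ε) ε, ∀ x ∈ Metric.ball x₀ ε, (ContDiffAt ℝ ∞ ψ (t, x) ∧
      flowEquation fC ((t, x), ψ (t, x)) = 0) ∧ ψ (t, x) ∈ Metric.ball (constCurve x₀) r :=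
    fun t ht x hx => H _ (Metric.ball_subset_ball (min_le_left _ _) (hmem t ht x hx))
  let one : UnitInterval := ⟨1, by norm_num⟩
  -- The flow is the end value `ψ (t, x) 1`. Rescaling does not increase the sup distance to the
  -- constant curve, so the rescaled solution stays in the ball of uniqueness and equals `ψ (σ t,
  -- x)`.
  have hscale : ∀ t ∈ Ioo (-ε) ε, ∀ x ∈ Metric.ball x₀ ε, ∀ σ : UnitInterval,
      ψ (σ * t, x) one = ψ (t, x) σ := by
    intro t ht x hx σ
    obtain ⟨⟨-, h2⟩, h3⟩ := H' t ht x hx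
    have hz := flowEquation_rescale h2 σ
    have hσt : (σ : ℝ) * t ∈ Ioo (-ε) ε := by
      rw [mem_Ioo, ← abs_lt, abs_mul]
      exact lt_of_le_of_lt (mul_le_of_le_one_left (abs_nonneg t) (abs_le.2 σ.2)) (abs_lt.2 ht)
    have hball : (((σ : ℝ) * t, x), rescale σ (ψ (t, x))) ∈
        Metric.ball (((0 : ℝ), x₀), constCurve x₀) r := by
      rw [← ball_prod_same]
      refine ⟨Metric.ball_subset_ball (min_le_right _ _) (hmem _ hσt x hx), ?_⟩
      rw [Metric.mem_ball, dist_eq_norm] at h3 ⊢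
      refine lt_of_le_of_lt ((ContinuousMap.norm_le _ (norm_nonneg _)).2 fun s => ?_) h3
      exact (ψ (t, x) - constCurve x₀).norm_coe_le_norm (projIcc (-1) 1 (by norm_num) (σ * s))
    have := hru _ hball hz
    simp only at this
    rw [this]
    have h1 : (σ : ℝ) * (one : ℝ) = σ := mul_one _
    change extend (ψ (t, x)) (σ * (one : ℝ)) = _
    rw [h1, extend_of_mem _ σ.2]
  refine ⟨ε, hε, fun z => ψ z one, fun z hz => ?_, fun x hx => ⟨?_, fun t ht => ?_⟩⟩
  · exact ((ContinuousMap.evalCLM ℝ one).contDiff.contDiffAt.comp z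
      (H' z.1 hz.1 z.2 hz.2).1.1).contDiffWithinAt
  · have := flowEquation_eq_zero_iff.1 (H' 0 (by simpa using hε) x hx).1.2 one
    simpa using this
  · set T := (|t| + ε) / 2
    have htε : |t| < ε := abs_lt.2 ht
    have hT : 0 < T := by have := abs_nonneg t; simp only [T]; linarith
    have hTε : T ∈ Ioo (-ε) ε := ⟨by linarith, by simp only [T]; linarith⟩
    have htT : |t| < T := by simp only [T]; linarith
    have hI : ∀ s, |s| < T → s / T ∈ Icc (-1 : ℝ) 1 := fun s hs => by
      rw [mem_Icc, ← abs_le, abs_div, abs_of_pos hT]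
      exact (div_le_one hT).2 hs.le
    have hval : ∀ s (hs : |s| < T), ψ (s, x) one = ψ (T, x) ⟨s / T, hI s hs⟩ := fun s hs => by
      rw [← hscale T hTε x hx, div_mul_cancel₀ _ hT.ne']
    have heq := flowEquation_eq_zero_iff.1 (H' T hTε x hx).1.2
    have hev : (fun s => ψ (s, x) one) =ᶠ[𝓝 t]
        fun s => x + T • ∫ r in (0 : ℝ)..(s / T), f (extend (ψ (T, x)) r) := by
      filter_upwards [(continuous_abs.isOpen_preimage _ isOpen_Iio).mem_nhds htT] with s hs
      rw [hval s hs, heq]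
      rfl
    refine HasDerivAt.congr_of_eventuallyEq ?_ hev
    have hcont : Continuous fun r => f (extend (ψ (T, x)) r) :=
      hf.continuous.comp (continuous_extend _)
    have h2 : HasDerivAt (fun s => ∫ r in (0 : ℝ)..s, f (extend (ψ (T, x)) r))
        (f (extend (ψ (T, x)) (t / T))) (t / T) :=
      intervalIntegral.integral_hasDerivAt_right (hcont.intervalIntegrable _ _)
        (hcont.stronglyMeasurableAtFilter _ _) hcont.continuousAt
    have h3 := (h2.scomp t ((hasDerivAt_id t).div_const T)).const_smul T |>.const_add x
    change HasDerivAt _ (f (ψ (t, x) one)) t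
    rw [hval t htT]
    rw [extend_of_mem _ (hI t htT), smul_smul, mul_one_div_cancel hT.ne', one_smul] at h3
    exact h3

end Flow

end SmoothFlow

/-! ### Smooth local flows on manifolds -/

namespace SmoothFlow

open Set Filter Bundle

variable {E : Type*} [NormedAddCommGroup E] [NormedSpace ℝ E]
  {H : Type*} [TopologicalSpace H] {I : ModelWithCorners ℝ E H}
  {P : Type*} [TopologicalSpace P] [ChartedSpace H P] [IsManifold I ∞ P]

lemma trivializationAt_snd_eq_mfderiv {p₀ p : P} (hp : p ∈ (chartAt H p₀).source)
    (v : TangentSpace I p) :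
    (trivializationAt E (TangentSpace I) p₀ ⟨p, v⟩).2 =
      mfderiv I 𝓘(ℝ, E) (extChartAt I p₀) p v := by
  have hb : p ∈ (trivializationAt E (TangentSpace I) p₀).baseSet := by simpa using hp
  rw [← TangentBundle.continuousLinearMapAt_trivializationAt hp]
  exact (congrFun (Trivialization.coe_linearMapAt_of_mem (R := ℝ) _ hb) v).symm

/-- A vector field written in a chart. -/
noncomputable def chartField (Z : (p : P) → TangentSpace I p) (p₀ : P) (z : E) : E :=
  mfderiv I 𝓘(ℝ, E) (extChartAt I p₀) ((extChartAt I p₀).symm z) (Z ((extChartAt I p₀).symm z))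

lemma contDiffOn_chartField {Z : (p : P) → TangentSpace I p}
    (hZ : ContMDiff I I.tangent ∞ (fun p => (⟨p, Z p⟩ : TangentBundle I P))) (p₀ : P) :
    ContDiffOn ℝ ∞ (chartField Z p₀) (extChartAt I p₀).target := by
  have h1 := (Trivialization.contMDiffOn_section_baseSet_iff (IB := I) (n := ∞)
    (s := Z) (trivializationAt E (TangentSpace I) p₀)).1 hZ.contMDiffOn
  have h2 : ContMDiffOn I 𝓘(ℝ, E) ∞
      (fun p => mfderiv I 𝓘(ℝ, E) (extChartAt I p₀) p (Z p) : P → E) (chartAt H p₀).source := by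
    rw [TangentBundle.trivializationAt_baseSet] at h1
    exact h1.congr fun p hp => (trivializationAt_snd_eq_mfderiv hp (Z p)).symm
  have h3 := h2.comp (contMDiffOn_extChartAt_symm (n := ∞) (I := I) p₀) fun z hz => by
    rw [mem_preimage, ← extChartAt_source I p₀]
    exact (extChartAt I p₀).map_target hz
  exact contMDiffOn_iff_contDiffOn.1 h3

lemma hasMFDerivAt_extChartAt_symm_comp {Z : (p : P) → TangentSpace I p} {p₀ : P} {c : ℝ → E}
    {t : ℝ} (hct : c t ∈ interior (extChartAt I p₀).target)
    (hc : HasDerivAt c (chartField Z p₀ (c t)) t) :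
    HasMFDerivAt 𝓘(ℝ, ℝ) I (fun s => (extChartAt I p₀).symm (c s)) t
      ((1 : ℝ →L[ℝ] ℝ).smulRight (Z ((extChartAt I p₀).symm (c t)))) := by
  have hct' := interior_subset hct
  have h1 : HasMFDerivAt 𝓘(ℝ, E) I (extChartAt I p₀).symm (c t)
      (mfderivWithin 𝓘(ℝ, E) I (extChartAt I p₀).symm (range I) (c t)) :=
    (mdifferentiableWithinAt_extChartAt_symm hct').hasMFDerivWithinAt.hasMFDerivAt
      (mem_of_superset (mem_interior_iff_mem_nhds.1 hct) (extChartAt_target_subset_range p₀))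
  have h2 : HasMFDerivAt 𝓘(ℝ, ℝ) 𝓘(ℝ, E) c t
      (((1 : ℝ →L[ℝ] ℝ).smulRight (chartField Z p₀ (c t)) : ℝ →L[ℝ] E)) :=
    (hasDerivAt_iff_hasFDerivAt.1 hc).hasMFDerivAt
  refine (h1.comp t h2).congr_mfderiv ?_
  have h3 := mfderivWithin_extChartAt_symm_comp_mfderiv_extChartAt (I := I) hct'
  let L : E →L[ℝ] E := mfderivWithin 𝓘(ℝ, E) I (extChartAt I p₀).symm (range I) (c t)
  let w : E := Z ((extChartAt I p₀).symm (c t))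
  have h4 : L (chartField Z p₀ (c t)) = w :=
    DFunLike.congr_fun h3 (Z ((extChartAt I p₀).symm (c t)))
  refine ContinuousLinearMap.ext fun s : ℝ => ?_
  have h5 : L (s • chartField Z p₀ (c t)) = s • w := by rw [map_smul, h4]
  exact h5

/-- A smooth vector field on a manifold without boundary has a smooth local flow. -/
theorem exists_smooth_local_flow [FiniteDimensional ℝ E] [BoundarylessManifold I P]
    {Z : (p : P) → TangentSpace I p}
    (hZ : ContMDiff I I.tangent ∞ (fun p => (⟨p, Z p⟩ : TangentBundle I P))) (p₀ : P) :
    ∃ N : Set P, IsOpen N ∧ p₀ ∈ N ∧ ∃ ε > 0, ∃ φ : ℝ × P → P,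
      ContMDiffOn (𝓘(ℝ, ℝ).prod I) I ∞ φ (Ioo (-ε) ε ×ˢ N) ∧
      ∀ q ∈ N, φ (0, q) = q ∧ IsMIntegralCurveOn (fun t => φ (t, q)) Z (Ioo (-ε) ε) := by
  set e := extChartAt I p₀ with he
  have : CompleteSpace E := FiniteDimensional.complete ℝ E
  have hint : e.target ∈ 𝓝 (e p₀) := mem_interior_iff_mem_nhds.1
    ((I.isInteriorPoint_iff).1 BoundarylessManifold.isInteriorPoint)
  obtain ⟨R, hR, hRt⟩ := Metric.nhds_basis_closedBall.mem_iff.1 (interior_mem_nhds.2 hint)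
  -- The cut-off extends the chart field smoothly to all of `E`. It is `1` on the ball of radius `R
  -- / 2`, where the flow is kept below, so the cut-off flow is the true one.
  let χ : ContDiffBump (e p₀) := ⟨R / 2, R, by positivity, by linarith⟩
  let f : E → E := fun z => χ z • chartField Z p₀ z
  have hf : ContDiff ℝ ∞ f := by
    rw [contDiff_iff_contDiffAt]
    intro z
    by_cases hz : z ∈ Metric.closedBall (e p₀) R
    · exact χ.contDiff.contDiffAt.smul ((contDiffOn_chartField hZ p₀).contDiffAt
        (mem_interior_iff_mem_nhds.1 (hRt hz)))
    · have : f =ᶠ[𝓝 z] fun _ => 0 := by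
        filter_upwards [Metric.isClosed_closedBall.isOpen_compl.mem_nhds hz] with y hy
        have : χ y = 0 := χ.zero_of_le_dist (le_of_lt (by simpa using hy))
        simp [f, this]
      exact contDiffAt_const.congr_of_eventuallyEq this
  obtain ⟨ε, hε, φ, hφ, hφc⟩ := exists_smooth_flow hf (e p₀)
  have hcont : ContinuousAt φ (0, e p₀) :=
    (hφ.continuousOn).continuousAt (prod_mem_nhds (Ioo_mem_nhds (by linarith) hε)
      (Metric.ball_mem_nhds _ hε))
  have h0 : φ (0, e p₀) = e p₀ := (hφc _ (Metric.mem_ball_self hε)).1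
  have hev : ∀ᶠ z in 𝓝 ((0 : ℝ), e p₀), φ z ∈ Metric.ball (e p₀) (R / 2) :=
    hcont.eventually_mem (by rw [h0]; exact Metric.ball_mem_nhds _ (by positivity))
  obtain ⟨δ', hδ', hδφ⟩ := Metric.eventually_nhds_iff_ball.1 hev
  set δ := min δ' ε
  have hδ : 0 < δ := lt_min hδ' hε
  have hIδ : Ioo (-δ) δ ⊆ Ioo (-ε) ε :=
    Ioo_subset_Ioo (neg_le_neg (min_le_right _ _)) (min_le_right _ _)
  have hBδ : Metric.ball (e p₀) δ ⊆ Metric.ball (e p₀) ε := Metric.ball_subset_ball (min_le_right _ _)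
  have hmem : ∀ t ∈ Ioo (-δ) δ, ∀ x ∈ Metric.ball (e p₀) δ,
      φ (t, x) ∈ Metric.ball (e p₀) (R / 2) := by
    intro t ht x hx
    refine hδφ _ (Metric.ball_subset_ball (min_le_left δ' ε) ?_)
    rw [← ball_prod_same]
    exact ⟨by rw [Metric.mem_ball, Real.dist_eq, sub_zero]; exact abs_lt.2 ht, hx⟩
  have hinner : Metric.ball (e p₀) (R / 2) ⊆ interior e.target :=
    (Metric.ball_subset_closedBall.trans (Metric.closedBall_subset_closedBall (by linarith))).trans
      hRt
  set N : Set P := e.source ∩ e ⁻¹' Metric.ball (e p₀) δ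
  have hNs : N ⊆ (chartAt H p₀).source := fun q hq => by
    have := hq.1; rwa [he, extChartAt_source] at this
  refine ⟨N, isOpen_extChartAt_preimage' p₀ Metric.isOpen_ball,
    ⟨mem_extChartAt_source p₀, Metric.mem_ball_self hδ⟩, δ, hδ,
    fun z => e.symm (φ (z.1, e z.2)), ?_, fun q hq => ⟨?_, fun t ht => ?_⟩⟩
  · have h1 : ContMDiffOn (𝓘(ℝ, ℝ).prod I) 𝓘(ℝ, ℝ × E) ∞ (fun z : ℝ × P => (z.1, e z.2))
        (Ioo (-δ) δ ×ˢ N) := by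
      have ha : ContMDiffOn (𝓘(ℝ, ℝ).prod I) 𝓘(ℝ, E) ∞ (fun z : ℝ × P => e z.2)
          (Ioo (-δ) δ ×ˢ N) :=
        (contMDiffOn_extChartAt (n := ∞)).comp contMDiffOn_snd fun z hz => hNs hz.2
      exact contMDiffOn_fst.prodMk_space ha
    have h2 := (contMDiffOn_iff_contDiffOn.2 hφ).comp h1 fun z hz => ⟨hIδ hz.1, hBδ hz.2.2⟩
    exact (contMDiffOn_extChartAt_symm (n := ∞) (I := I) p₀).comp h2 fun z hz =>
      show φ (z.1, e z.2) ∈ e.target from interior_subset (hinner (hmem _ hz.1 _ hz.2.2))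
  · simp only
    rw [(hφc _ (hBδ hq.2)).1]
    exact e.left_inv hq.1
  · have hin := hmem t ht _ hq.2
    have hd := (hφc _ (hBδ hq.2)).2 t (hIδ ht)
    have hone : χ (φ (t, e q)) = 1 := χ.one_of_mem_closedBall (Metric.ball_subset_closedBall hin)
    simp only [f, hone, one_smul] at hd
    exact (hasMFDerivAt_extChartAt_symm_comp (hinner hin) hd).hasMFDerivWithinAt

end SmoothFlow

/-! ### Smoothness of integrals depending on a parameter -/

namespace ParametricIntegral

open Set Filter MeasureTheory

variable {EG : Type*} [NormedAddCommGroup EG] [NormedSpace ℝ EG]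
  {HG : Type*} [TopologicalSpace HG] {IG : ModelWithCorners ℝ EG HG}
  {G : Type*} [TopologicalSpace G] [ChartedSpace HG G] [R1Space G]
  [MeasurableSpace G] [BorelSpace G] {μ : Measure G} [IsFiniteMeasureOnCompacts μ]
  {E : Type*} [NormedAddCommGroup E] [NormedSpace ℝ E] [FiniteDimensional ℝ E]
  {F : Type*} [NormedAddCommGroup F] [NormedSpace ℝ F]

omit [R1Space G] [MeasurableSpace G] [BorelSpace G] [FiniteDimensional ℝ E] in
lemma contMDiffOn_fderiv_left [IsManifold IG ∞ G] {K : E → G → F} {U : Set E} (hU : IsOpen U)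
    (hK : ContMDiffOn (𝓘(ℝ, E).prod IG) 𝓘(ℝ, F) ∞ (Function.uncurry K) (U ×ˢ univ)) :
    ContMDiffOn (𝓘(ℝ, E).prod IG) 𝓘(ℝ, E →L[ℝ] F) ∞
      (fun z : E × G => fderiv ℝ (fun x => K x z.2) z.1) (U ×ˢ univ) := by
  rintro ⟨x, g⟩ hz
  have hKz : ContMDiffAt (𝓘(ℝ, E).prod IG) 𝓘(ℝ, F) ∞ (Function.uncurry K) (x, g) :=
    hK.contMDiffAt ((hU.prod isOpen_univ).mem_nhds hz)
  have h1 : ContMDiffAt ((𝓘(ℝ, E).prod IG).prod 𝓘(ℝ, E)) 𝓘(ℝ, F) ∞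
      (Function.uncurry fun (z : E × G) (y : E) => K y z.2) ((x, g), x) := by
    have h2 : ContMDiff ((𝓘(ℝ, E).prod IG).prod 𝓘(ℝ, E)) (𝓘(ℝ, E).prod IG) ∞
        (fun w : (E × G) × E => (w.2, w.1.2)) :=
      contMDiff_snd.prodMk (contMDiff_snd.comp contMDiff_fst)
    exact ContMDiffAt.comp ((x, g), x) (g := Function.uncurry K) hKz h2.contMDiffAt
  have h3 := ContMDiffAt.mfderiv (m := ∞) (fun (z : E × G) (y : E) => K y z.2)
    (fun z : E × G => z.1) h1 contMDiffAt_fst (by simp)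
  simp only [inTangentCoordinates_model_space, mfderiv_eq_fderiv] at h3
  exact h3.contMDiffWithinAt

omit [NormedSpace ℝ F] in
lemma integrable_of_zero_off_compact {f : G → F} {k : Set G} (hk : IsCompact k)
    (hf : Continuous f) (h0 : ∀ g ∉ k, f g = 0) : Integrable f μ :=
  hf.integrable_of_hasCompactSupport (HasCompactSupport.intro hk h0)

lemma hasFDerivAt_integral [IsManifold IG ∞ G] {K : E → G → F} {U : Set E} (hU : IsOpen U)
    {k : Set G} (hk : IsCompact k) (h0 : ∀ x ∈ U, ∀ g ∉ k, K x g = 0)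
    (hK : ContMDiffOn (𝓘(ℝ, E).prod IG) 𝓘(ℝ, F) ∞ (Function.uncurry K) (U ×ˢ univ))
    {x : E} (hx : x ∈ U) :
    HasFDerivAt (fun y => ∫ g, K y g ∂μ) (∫ g, fderiv ℝ (fun y => K y g) x ∂μ) x ∧
      Integrable (fun g => fderiv ℝ (fun y => K y g) x) μ := by
  have hD := (contMDiffOn_fderiv_left hU hK).continuousOn
  have hline : ∀ y : E, Continuous (fun g : G => (y, g)) := fun y => by fun_prop
  have hKc : ∀ y ∈ U, Continuous (K y) := fun y hy =>
    hK.continuousOn.comp_continuous (hline y) fun g => ⟨hy, mem_univ g⟩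
  have hDc : Continuous (fun g => fderiv ℝ (fun y => K y g) x) :=
    hD.comp_continuous (hline x) fun g => ⟨hx, mem_univ g⟩
  have hD0 : ∀ y ∈ U, ∀ g ∉ k, fderiv ℝ (fun y => K y g) y = 0 := by
    intro y hy g hg
    have : (fun y => K y g) =ᶠ[𝓝 y] fun _ => 0 := by
      filter_upwards [hU.mem_nhds hy] with z hz using h0 z hz g hg
    rw [this.fderiv_eq, fderiv_fun_const, Pi.zero_apply]
  have hint : Integrable (fun g => fderiv ℝ (fun y => K y g) x) μ :=
    integrable_of_zero_off_compact hk hDc (hD0 x hx)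
  refine ⟨?_, hint⟩
  have : ProperSpace E := FiniteDimensional.proper ℝ E
  obtain ⟨r, hr, hrU⟩ := Metric.nhds_basis_closedBall.mem_iff.1 (hU.mem_nhds hx)
  obtain ⟨C, hC⟩ := ((isCompact_closedBall x r).prod hk.closure).exists_bound_of_continuousOn
    (hD.mono (prod_mono hrU (subset_univ _)))
  -- The derivative is bounded on (closed ball) × `closure k`. The closure is taken because `G` is
  -- only assumed `R1`, where a compact set need not be closed but has compact closure.
  refine hasFDerivAt_integral_of_dominated_of_fderiv_le (𝕜 := ℝ)
    (F' := fun y g => fderiv ℝ (fun y => K y g) y)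
    (bound := (closure k).indicator fun _ => C) (Metric.closedBall_mem_nhds x hr) ?_
    (integrable_of_zero_off_compact hk (hKc x hx) (h0 x hx)) hint.1 ?_ ?_ ?_
  · filter_upwards [hU.mem_nhds hx] with y hy
    exact (integrable_of_zero_off_compact hk (hKc y hy) (h0 y hy)).1
  · refine Eventually.of_forall fun g y hy => ?_
    by_cases hg : g ∈ closure k
    · simpa [hg] using hC (y, g) ⟨hy, hg⟩
    · simp [hg, hD0 y (hrU hy) g fun h => hg (subset_closure h)]
  · exact (integrable_indicator_iff isClosed_closure.measurableSet).2
      (integrableOn_const hk.closure.measure_lt_top.ne)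
  · refine Eventually.of_forall fun g y hy => ?_
    have h1 : ContMDiffAt 𝓘(ℝ, E) 𝓘(ℝ, F) ∞ (fun y => K y g) y := by
      have h2 : ContMDiffAt (𝓘(ℝ, E).prod IG) 𝓘(ℝ, F) ∞ (Function.uncurry K) (y, g) :=
        hK.contMDiffAt ((hU.prod isOpen_univ).mem_nhds ⟨hrU hy, mem_univ g⟩)
      exact ContMDiffAt.comp y (g := Function.uncurry K) (f := fun y => (y, g)) h2
        (contMDiffAt_id.prodMk contMDiffAt_const)
    exact (h1.contDiffAt.differentiableAt (by simp)).hasFDerivAt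

/-- Differentiating under the integral in a fixed direction `v` gives a kernel of the same kind,
with values still in `F` and support still in `k`, so the induction runs over `K`. -/
lemma contDiffOn_integral_nat [IsManifold IG ∞ G] {U : Set E} (hU : IsOpen U)
    {k : Set G} (hk : IsCompact k) (n : ℕ) : ∀ K : E → G → F,
      (∀ x ∈ U, ∀ g ∉ k, K x g = 0) →
      ContMDiffOn (𝓘(ℝ, E).prod IG) 𝓘(ℝ, F) ∞ (Function.uncurry K) (U ×ˢ univ) →
      ContDiffOn ℝ n (fun x => ∫ g, K x g ∂μ) U := by
  induction n with
  | zero =>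
    intro K h0 hK
    exact contDiffOn_zero.2 (continuousOn_integral_of_compact_support hk hK.continuousOn
      fun x g hx hg => h0 x hx g hg)
  | succ n ih =>
    intro K h0 hK
    have hd := fun x hx => hasFDerivAt_integral (μ := μ) hU hk h0 hK (x := x) hx
    push_cast
    refine (contDiffOn_succ_iff_fderiv_apply hU.uniqueDiffOn).2
      ⟨fun x hx => (hd x hx).1.differentiableAt.differentiableWithinAt, by simp, fun v => ?_⟩
    have hK' : ContMDiffOn (𝓘(ℝ, E).prod IG) 𝓘(ℝ, F) ∞
        (Function.uncurry fun x g => fderiv ℝ (fun y => K y g) x v) (U ×ˢ univ) :=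
      (contMDiffOn_fderiv_left hU hK).clm_apply contMDiffOn_const
    refine (ih (fun x g => fderiv ℝ (fun y => K y g) x v) (fun x hx g hg => ?_) hK').congr
      fun x hx => ?_
    · have : (fun y => K y g) =ᶠ[𝓝 x] fun _ => 0 := by
        filter_upwards [hU.mem_nhds hx] with z hz using h0 z hz g hg
      rw [this.fderiv_eq, fderiv_fun_const, Pi.zero_apply, zero_apply]
    · rw [fderivWithin_of_isOpen hU hx, (hd x hx).1.fderiv,
        ContinuousLinearMap.integral_apply (hd x hx).2]

variable {H : Type*} [TopologicalSpace H] {I : ModelWithCorners ℝ E H}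
  {P : Type*} [TopologicalSpace P] [ChartedSpace H P] [IsManifold I ∞ P]

/-- The integral of a compactly supported family of functions that depends smoothly on a parameter
in a manifold is a smooth function of the parameter. -/
theorem contMDiffAt_integral [IsManifold IG ∞ G] [BoundarylessManifold I P] {K : P → G → F}
    {V : Set P} (hV : IsOpen V) {k : Set G} (hk : IsCompact k) (h0 : ∀ x ∈ V, ∀ g ∉ k, K x g = 0)
    (hK : ContMDiffOn (I.prod IG) 𝓘(ℝ, F) ∞ (Function.uncurry K) (V ×ˢ univ))
    {p : P} (hp : p ∈ V) : ContMDiffAt I 𝓘(ℝ, F) ∞ (fun q => ∫ g, K q g ∂μ) p := by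
  set e := extChartAt I p
  have hpi : e p ∈ interior e.target :=
    (I.isInteriorPoint_iff).1 BoundarylessManifold.isInteriorPoint
  set U : Set E := interior e.target ∩ e.symm ⁻¹' V
  have hU : IsOpen U :=
    ((continuousOn_extChartAt_symm p).mono interior_subset).isOpen_inter_preimage
      isOpen_interior hV
  have hpU : e p ∈ U := ⟨hpi, by
    rw [mem_preimage, e.left_inv (mem_extChartAt_source p)]; exact hp⟩
  have hK' : ContMDiffOn (𝓘(ℝ, E).prod IG) 𝓘(ℝ, F) ∞
      (Function.uncurry fun x g => K (e.symm x) g) (U ×ˢ univ) := by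
    have h1 : ContMDiffOn (𝓘(ℝ, E).prod IG) (I.prod IG) ∞
        (fun z : E × G => (e.symm z.1, z.2)) (U ×ˢ univ) :=
      ((contMDiffOn_extChartAt_symm (n := ∞) p).comp contMDiffOn_fst
        fun z hz => show z.1 ∈ e.target from interior_subset hz.1.1).prodMk contMDiffOn_snd
    exact hK.comp h1 fun z hz => ⟨hz.1.2, mem_univ _⟩
  have h2 : ContDiffOn ℝ ∞ (fun x => ∫ g, K (e.symm x) g ∂μ) U :=
    contDiffOn_infty.2 fun n => contDiffOn_integral_nat hU hk n _
      (fun x hx g hg => h0 _ hx.2 g hg) hK'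
  have h3 : ContMDiffAt I 𝓘(ℝ, F) ∞ (fun q => ∫ g, K (e.symm (e q)) g ∂μ) p :=
    ContMDiffAt.comp (I' := 𝓘(ℝ, E)) p (g := fun x => ∫ g, K (e.symm x) g ∂μ) (f := e)
      ((h2.contDiffAt (hU.mem_nhds hpU)).contMDiffAt) contMDiffAt_extChartAt
  refine h3.congr_of_eventuallyEq ?_
  filter_upwards [extChartAt_source_mem_nhds (I := I) p] with q hq
  rw [e.left_inv hq]

end ParametricIntegral

/-! ### Averaging functions and vector fields over the group -/

namespace OrbitSpace

set_option linter.unusedSectionVars false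

open Set Filter MeasureTheory Bundle

variable {EG : Type*} [NormedAddCommGroup EG] [NormedSpace ℝ EG]
  {HG : Type*} [TopologicalSpace HG] (IG : ModelWithCorners ℝ EG HG)
  {G : Type*} [Group G] [TopologicalSpace G] [ChartedSpace HG G] [LieGroup IG ∞ G]
  {E : Type*} [NormedAddCommGroup E] [NormedSpace ℝ E] [FiniteDimensional ℝ E]
  {H : Type*} [TopologicalSpace H] (I : ModelWithCorners ℝ E H)
  {P : Type*} [TopologicalSpace P] [ChartedSpace H P] [IsManifold I ∞ P]
  [MulAction G P] [ContMDiffSMul IG I ∞ G P]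

/-- The push-forward of a vector field, as a vector in the model space. -/
noncomputable def pushVec (X : (p : P) → TangentSpace I p) (g : G) (p : P) : E :=
  pushforwardAction I g X p

/-- The differential of the action of a group element, as a map on the model space. -/
noncomputable def actDeriv (g : G) (p : P) : E →L[ℝ] E := mfderiv I I (fun q : P => g • q) p

section Action

include IG in
lemma contMDiff_smul_left (g : G) : ContMDiff I I ∞ (fun p : P => g • p) :=
  (contMDiff_smul (I := IG) (I' := I) (n := ∞) (G := G) (M := P)).comp
    (contMDiff_const.prodMk contMDiff_id)

include IG in
lemma mdifferentiableAt_smul_left (g : G) (p : P) :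
    MDifferentiableAt I I (fun p : P => g • p) p :=
  (contMDiff_smul_left IG I g).mdifferentiable (by simp) p

lemma contMDiff_inv_smul : ContMDiff (I.prod IG) I ∞ (fun z : P × G => z.2⁻¹ • z.1) :=
  (contMDiff_smul (I := IG) (I' := I) (n := ∞) (G := G) (M := P)).comp
    ((contMDiff_snd.inv).prodMk contMDiff_fst)

variable {I} in
/-- The push-forward of a smooth vector field depends smoothly on the group element. -/
lemma contMDiff_pushforwardAction {X : (p : P) → TangentSpace I p}
    (hX : ContMDiff I I.tangent ∞ (fun p => (⟨p, X p⟩ : TangentBundle I P))) :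
    ContMDiff (I.prod IG) I.tangent ∞ (fun z : P × G =>
      (⟨z.1, pushforwardAction I z.2 X z.1⟩ : TangentBundle I P)) := by
  have : IsManifold IG ∞ G := inferInstance
  have hα := contMDiff_smul (I := IG) (I' := I) (n := ∞) (G := G) (M := P)
  -- The push-forward is the tangent map of the action `G × P → P` applied to the zero vector at `g`
  -- paired with `X (g⁻¹ p)`, a composite of smooth maps.
  have h1 : ContMDiff (I.prod IG) (IG.prod I).tangent ∞ (fun z : P × G =>
      (equivTangentBundleProd IG G I P).symm
        (zeroSection EG (TangentSpace IG) z.2, ⟨z.2⁻¹ • z.1, X (z.2⁻¹ • z.1)⟩)) := by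
    refine (contMDiff_equivTangentBundleProd_symm (n := ∞)).comp (ContMDiff.prodMk ?_ ?_)
    · exact (contMDiff_zeroSection ℝ (TangentSpace IG : G → Type _)).comp contMDiff_snd
    · exact hX.comp (contMDiff_inv_smul IG I)
  have h2 := (hα.contMDiff_tangentMap (m := ∞) (by simp)).comp h1
  convert h2 using 1
  funext z
  have key : ∀ (a b : P) (v w : E), a = b → v = w →
      (⟨a, v⟩ : TangentBundle I P) = ⟨b, w⟩ := by rintro a _ v _ rfl rfl; rfl
  refine key _ _ _ _ (smul_inv_smul z.2 z.1).symm ?_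
  have hd : MDifferentiableAt (IG.prod I) I (fun p : G × P => p.1 • p.2) (z.2, z.2⁻¹ • z.1) :=
    hα.mdifferentiable (by simp) _
  have hcomp := mfderiv_comp (z.2⁻¹ • z.1) (I := I) (I' := IG.prod I) (I'' := I)
    (g := fun p : G × P => p.1 • p.2) (f := fun q : P => (z.2, q)) hd
    (mdifferentiableAt_const.prodMk mdifferentiableAt_id)
  rw [mfderiv_prod_right] at hcomp
  exact DFunLike.congr_fun hcomp (X (z.2⁻¹ • z.1))

include IG in
lemma pushforwardAction_mul (X : (p : P) → TangentSpace I p) (h g : G) (q : P) :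
    pushVec I X (h * g) (h • q) =
      actDeriv I h q (pushVec I X g q) := by
  have hq : (h * g)⁻¹ • h • q = g⁻¹ • q := by simp [mul_smul]
  have hcomp := mfderiv_comp (g⁻¹ • q) (I := I) (I' := I) (I'' := I)
    (g := fun p : P => h • p) (f := fun p : P => g • p)
    (mdifferentiableAt_smul_left IG I h _) (mdifferentiableAt_smul_left IG I g _)
  have e1 : (fun p : P => h • p) ∘ (fun p : P => g • p) = fun p : P => (h * g) • p := by
    funext p; simp [mul_smul]
  rw [e1] at hcomp
  -- Equal base points give tangent spaces that agree only propositionally; reading vectors in `E`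
  -- permits the transport.
  have key : ∀ (a b : P), a = b → ((mfderiv I I (fun p : P => (h * g) • p) a (X a) : E) =
      mfderiv I I (fun p : P => (h * g) • p) b (X b)) := by rintro a _ rfl; rfl
  have key2 : ∀ (a b : P) (v : E), a = b → ((mfderiv I I (fun p : P => h • p) a v : E) =
      mfderiv I I (fun p : P => h • p) b v) := by rintro a _ v rfl; rfl
  refine (key _ _ hq).trans ((DFunLike.congr_fun hcomp (X (g⁻¹ • q))).trans ?_)
  exact key2 _ _ _ (smul_inv_smul g q)

end Action

section Average

variable [MeasurableSpace G] [BorelSpace G] (μ : Measure G)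

/-- The average over the group of a function on `P`. -/
noncomputable def average (χ : P → ℝ) (p : P) : ℝ := ∫ g, χ (g⁻¹ • p) ∂μ

/-- The average over the group of a vector field on `P`, with weight `χ`. -/
noncomputable def averageField (χ : P → ℝ) (X : (p : P) → TangentSpace I p) (p : P) :
    TangentSpace I p :=
  (∫ g, χ (g⁻¹ • p) • pushVec I X g p ∂μ : E)

variable {μ} {χ : P → ℝ}

/-- Properness: the set of `g` moving the support of `χ` to meet `C` is compact. One `k` serves all
of `C`, as differentiation under the integral requires. -/
lemma exists_compact_of_hasCompactSupport [ProperSMul G P] (hχ : HasCompactSupport χ) {C : Set P}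
    (hC : IsCompact C) : ∃ k : Set G, IsCompact k ∧ ∀ p ∈ C, ∀ g ∉ k, χ (g⁻¹ • p) = 0 := by
  refine ⟨_, ProperSMul.isCompact_setOfPred_inter_nonempty hχ hC, fun p hp g hg => ?_⟩
  by_contra hne
  exact hg ⟨p, ⟨g⁻¹ • p, subset_tsupport χ hne, smul_inv_smul g p⟩, hp⟩

/-- Since `(h g)⁻¹ h = g⁻¹`, left invariance is enough; `G` need not be unimodular. -/
lemma average_smul [IsTopologicalGroup G] [μ.IsMulLeftInvariant] (h : G) (p : P) :
    average μ χ (h • p) = average μ χ p := by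
  rw [average, ← integral_mul_left_eq_self _ h, average]
  simp [mul_smul]

lemma average_eq_zero {p : P} (h : ∀ g : G, χ (g • p) = 0) : average μ χ p = 0 := by
  simp [average, h]

include IG in
-- The differential of `h` passes through the integral and turns `g_* X` into `(h g)_* X`; the
-- substitution `g ↦ h g` does the rest.
lemma averageField_smul [IsTopologicalGroup G] [μ.IsMulLeftInvariant]
    {X : (p : P) → TangentSpace I p} (h : G) (q : P)
    (hint : Integrable (fun g : G => χ (g⁻¹ • q) • pushVec I X g q) μ) :
    mfderiv I I (fun p : P => h • p) q (averageField I μ χ X q) =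
      averageField I μ χ X (h • q) := by
  have h1 : (∫ g, χ (g⁻¹ • h • q) • pushVec I X g (h • q) ∂μ : E) =
      (∫ g, χ (g⁻¹ • q) • pushVec I X (h * g) (h • q) ∂μ : E) := by
    rw [← integral_mul_left_eq_self _ h]
    simp [mul_smul]
  have h2 := (actDeriv I h q).integral_comp_comm hint
  refine h2.symm.trans (Eq.trans (integral_congr_ae (Eventually.of_forall fun g => ?_)) h1.symm)
  simp only
  rw [pushforwardAction_mul IG I X h g q, map_smul]

variable [IsFiniteMeasureOnCompacts μ] [R1Space G] [BoundarylessManifold I P] [ProperSMul G P]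

include IG in
lemma contMDiff_average (hχ : ContMDiff I 𝓘(ℝ, ℝ) ∞ χ) (hc : HasCompactSupport χ) :
    ContMDiff I 𝓘(ℝ, ℝ) ∞ (average μ χ) := by
  have : IsManifold IG ∞ G := inferInstance
  have : LocallyCompactSpace P := Manifold.locallyCompact_of_finiteDimensional I
  intro p
  obtain ⟨C, hC, hpC⟩ := exists_compact_mem_nhds p
  obtain ⟨k, hk, h0⟩ := exists_compact_of_hasCompactSupport (G := G) hc hC
  exact ParametricIntegral.contMDiffAt_integral (IG := IG) (K := fun p g => χ (g⁻¹ • p))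
    isOpen_interior hk (fun x hx => h0 x (interior_subset hx))
    (hχ.comp (contMDiff_inv_smul IG I)).contMDiffOn (mem_interior_iff_mem_nhds.2 hpC)

lemma average_pos [μ.IsOpenPosMeasure] (hχ : Continuous χ) (hc : HasCompactSupport χ)
    (h0 : 0 ≤ χ) {p : P} (hp : χ p ≠ 0) [IsTopologicalGroup G] : 0 < average μ χ p := by
  obtain ⟨k, hk, hk0⟩ := exists_compact_of_hasCompactSupport (G := G) hc (isCompact_singleton (x := p))
  refine Continuous.integral_pos_of_hasCompactSupport_nonneg_nonzero (x := (1 : G))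
    (by fun_prop) (HasCompactSupport.intro hk (hk0 p rfl)) (fun g => h0 _) (by simpa using hp)

lemma contMDiffOn_averageField_integrand {X : (p : P) → TangentSpace I p}
    (hX : ContMDiff I I.tangent ∞ (fun p => (⟨p, X p⟩ : TangentBundle I P)))
    (hχ : ContMDiff I 𝓘(ℝ, ℝ) ∞ χ) (p₀ : P) :
    ContMDiffOn (I.prod IG) 𝓘(ℝ, E) ∞ (Function.uncurry fun (p : P) (g : G) => χ (g⁻¹ • p) •
      (trivializationAt E (TangentSpace I) p₀ ⟨p, pushforwardAction I g X p⟩).2)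
      ((trivializationAt E (TangentSpace I) p₀).baseSet ×ˢ univ) := by
  refine ((hχ.comp (contMDiff_inv_smul IG I)).contMDiffOn).smul ?_
  exact ((Trivialization.contMDiffOn_iff (e := trivializationAt E (TangentSpace I) p₀)
    (f := fun z : P × G => (⟨z.1, pushforwardAction I z.2 X z.1⟩ : TangentBundle I P))
    (fun z hz => by rw [Trivialization.mem_source]; exact hz.1)).1
      (contMDiff_pushforwardAction IG hX).contMDiffOn).2

lemma trivialization_smul {p₀ p : P} (hp : p ∈ (trivializationAt E (TangentSpace I) p₀).baseSet)
    (a : ℝ) (v : TangentSpace I p) :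
    Trivialization.continuousLinearEquivAt ℝ (trivializationAt E (TangentSpace I) p₀) p hp (a • v) =
      a • (trivializationAt E (TangentSpace I) p₀ ⟨p, v⟩).2 := by
  rw [map_smul]; rfl

include IG in
lemma integrable_averageField_integrand {X : (p : P) → TangentSpace I p}
    (hX : ContMDiff I I.tangent ∞ (fun p => (⟨p, X p⟩ : TangentBundle I P)))
    (hχ : ContMDiff I 𝓘(ℝ, ℝ) ∞ χ) (hc : HasCompactSupport χ) (p : P) :
    Integrable (fun g : G => χ (g⁻¹ • p) • pushVec I X g p) μ := by
  obtain ⟨k, hk, hk0⟩ := exists_compact_of_hasCompactSupport (G := G) hc (isCompact_singleton (x := p))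
  have hp : p ∈ (trivializationAt E (TangentSpace I) p).baseSet :=
    mem_baseSet_trivializationAt E (TangentSpace I) p
  have hcont : Continuous fun g : G => χ (g⁻¹ • p) •
      (trivializationAt E (TangentSpace I) p ⟨p, pushforwardAction I g X p⟩).2 :=
    (contMDiffOn_averageField_integrand IG I hX hχ p).continuousOn.comp_continuous
      (f := fun g : G => (p, g)) (by fun_prop) fun g => ⟨hp, mem_univ g⟩
  have hint := ParametricIntegral.integrable_of_zero_off_compact (μ := μ) hk hcont fun g hg => by
    rw [hk0 p rfl g hg, zero_smul]
  let L : E ≃L[ℝ] E :=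
    Trivialization.continuousLinearEquivAt ℝ (trivializationAt E (TangentSpace I) p) p hp
  refine (ContinuousLinearEquiv.integrable_comp_iff L).1 (hint.congr ?_)
  exact Eventually.of_forall fun g => (trivialization_smul I hp _ _).symm

include IG in
-- The trivialization is linear on fibres and so commutes with the integral; in it the average
-- becomes a parametric integral with values in the fixed space `E`.
lemma contMDiff_averageField {X : (p : P) → TangentSpace I p}
    (hX : ContMDiff I I.tangent ∞ (fun p => (⟨p, X p⟩ : TangentBundle I P)))
    (hχ : ContMDiff I 𝓘(ℝ, ℝ) ∞ χ) (hc : HasCompactSupport χ) :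
    ContMDiff I I.tangent ∞ (fun p => (⟨p, averageField I μ χ X p⟩ : TangentBundle I P)) := by
  have : IsManifold IG ∞ G := inferInstance
  have : LocallyCompactSpace P := Manifold.locallyCompact_of_finiteDimensional I
  intro p₀
  refine (contMDiffAt_section (IB := I) (n := ∞) (s := averageField I μ χ X) p₀).2 ?_
  set e := trivializationAt E (TangentSpace I) p₀
  have hp₀ : p₀ ∈ e.baseSet := mem_baseSet_trivializationAt E (TangentSpace I) p₀
  obtain ⟨C, hC, hpC⟩ := exists_compact_mem_nhds p₀
  obtain ⟨k, hk, h0⟩ := exists_compact_of_hasCompactSupport (G := G) hc hC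
  have hV : IsOpen (interior C ∩ e.baseSet) := isOpen_interior.inter e.open_baseSet
  have hpV : p₀ ∈ interior C ∩ e.baseSet := ⟨mem_interior_iff_mem_nhds.2 hpC, hp₀⟩
  have h1 := ParametricIntegral.contMDiffAt_integral (IG := IG) (μ := μ) (K := fun (p : P) (g : G) =>
      χ (g⁻¹ • p) • (e ⟨p, pushforwardAction I g X p⟩).2) hV hk
    (fun x hx g hg => by rw [h0 x (interior_subset hx.1) g hg, zero_smul])
    ((contMDiffOn_averageField_integrand IG I hX hχ p₀).mono
      (prod_mono inter_subset_right subset_rfl)) hpV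
  refine h1.congr_of_eventuallyEq ?_
  filter_upwards [e.open_baseSet.mem_nhds hp₀] with p hp
  let L : E ≃L[ℝ] E := Trivialization.continuousLinearEquivAt ℝ e p hp
  have h2 := L.integral_comp_comm (μ := μ)
    (fun g : G => χ (g⁻¹ • p) • pushVec I X g p)
  refine Eq.trans ?_ (h2.symm.trans (integral_congr_ae (Eventually.of_forall fun g => ?_)))
  · rfl
  · exact trivialization_smul I hp _ _

include IG in
-- A linear form that does not distinguish `g_* X` from `X` at `p` leaves the integral as a constant
-- factor. It is applied to differentials of invariant functions.
lemma apply_averageField {X : (p : P) → TangentSpace I p}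
    (hX : ContMDiff I I.tangent ∞ (fun p => (⟨p, X p⟩ : TangentBundle I P)))
    (hχ : ContMDiff I 𝓘(ℝ, ℝ) ∞ χ) (hc : HasCompactSupport χ) (p : P) (L : E →L[ℝ] ℝ)
    (hL : ∀ g : G, L (pushVec I X g p) = L (X p)) :
    L (averageField I μ χ X p) = average μ χ p * L (X p) := by
  have h := L.integral_comp_comm (integrable_averageField_integrand (μ := μ) IG I hX hχ hc p)
  refine h.symm.trans ?_
  simp only [map_smul, smul_eq_mul]
  rw [average, ← integral_mul_const]
  exact integral_congr_ae (Eventually.of_forall fun g => congrArg (χ (g⁻¹ • p) * ·) (hL g))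

end Average

end OrbitSpace

/-! ### Invariant functions, invariant bumps and the equivariant replacement of the field -/

namespace OrbitSpace

open Set Filter MeasureTheory Bundle

section Differential

variable {E : Type*} [NormedAddCommGroup E] [NormedSpace ℝ E]
  {H : Type*} [TopologicalSpace H] (I : ModelWithCorners ℝ E H)
  {P : Type*} [TopologicalSpace P] [ChartedSpace H P]

/-- The differential of a real function, as a linear form on the model space. -/
noncomputable def diff (F : P → ℝ) (p : P) : E →L[ℝ] ℝ := mfderiv I 𝓘(ℝ, ℝ) F p

end Differential

section Invariant

variable {EG : Type*} [NormedAddCommGroup EG] [NormedSpace ℝ EG]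
  {HG : Type*} [TopologicalSpace HG] (IG : ModelWithCorners ℝ EG HG)
  {G : Type*} [Group G] [TopologicalSpace G] [ChartedSpace HG G] [LieGroup IG ∞ G]
  {E : Type*} [NormedAddCommGroup E] [NormedSpace ℝ E]
  {H : Type*} [TopologicalSpace H] (I : ModelWithCorners ℝ E H)
  {P : Type*} [TopologicalSpace P] [ChartedSpace H P]
  [MulAction G P] [ContMDiffSMul IG I ∞ G P]

variable {F : P → ℝ} (hF : ContMDiff I 𝓘(ℝ, ℝ) ∞ F) (hFG : ∀ (g : G) (p : P), F (g • p) = F p)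

include IG hF hFG

omit [LieGroup IG ∞ G] in
lemma diff_smul_actDeriv (h : G) (q : P) (v : E) :
    diff I F (h • q) (actDeriv I h q v) = diff I F q v := by
  have hs : ContMDiff I I ∞ (fun p : P => h • p) :=
    (contMDiff_smul (I := IG) (I' := I) (n := ∞) (G := G) (M := P)).comp
      (contMDiff_const.prodMk contMDiff_id)
  have h1 := mfderiv_comp q (I := I) (I' := I) (I'' := 𝓘(ℝ, ℝ)) (g := F) (f := fun p : P => h • p)
    (hF.mdifferentiable (by simp) _) (hs.mdifferentiable (by simp) q)
  have h2 : F ∘ (fun p : P => h • p) = F := funext fun p => hFG h p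
  rw [h2] at h1
  exact (DFunLike.congr_fun h1 v).symm

omit [LieGroup IG ∞ G] in
-- An invariant function is constant along `g ↦ g p`; differentiate at the identity.
lemma diff_orbitTangentSpace {p : P} {u : E} (hu : u ∈ orbitTangentSpace I G IG p) :
    diff I F p u = 0 := by
  obtain ⟨v, rfl⟩ := hu
  have hs : ContMDiff IG I ∞ (fun g : G => g • p) :=
    (contMDiff_smul (I := IG) (I' := I) (n := ∞) (G := G) (M := P)).comp
      (contMDiff_id.prodMk contMDiff_const)
  have h1 := mfderiv_comp (1 : G) (I := IG) (I' := I) (I'' := 𝓘(ℝ, ℝ)) (g := F)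
    (f := fun g : G => g • p)
    (hF.mdifferentiable (by simp) _) (hs.mdifferentiable (by simp) 1)
  have h2 : F ∘ (fun g : G => g • p) = fun _ => F p := funext fun g => hFG g p
  rw [h2, mfderiv_const] at h1
  have key : ∀ (a b : P) (v : E), a = b → diff I F a v = diff I F b v := by rintro a _ v rfl; rfl
  refine (key _ _ _ (one_smul G p).symm).trans ?_
  exact (DFunLike.congr_fun h1 v).symm

variable {X : (p : P) → TangentSpace I p}
  (hinv : ∀ (g : G) (p : P), pushforwardAction I g X p - X p ∈ orbitTangentSpace I G IG p)

include hinv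

omit [LieGroup IG ∞ G] in
lemma diff_pushVec (g : G) (p : P) : diff I F p (pushVec I X g p) = diff I F p (X p) := by
  have h := diff_orbitTangentSpace IG I hF hFG (hinv g p)
  exact sub_eq_zero.1 ((map_sub (diff I F p) (pushVec I X g p) (X p)).symm.trans h)

omit [LieGroup IG ∞ G] in
-- This is the invariance of `X F`: `dF` sees no difference between `X` and `g_* X`, and `F ∘ g = F`
-- moves the differential from `g p` back to `p`.
lemma diff_smul_field (g : G) (p : P) :
    diff I F (g • p) (X (g • p)) = diff I F p (X p) := by
  refine (diff_pushVec IG I hF hFG hinv g (g • p)).symm.trans ?_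
  refine Eq.trans ?_ (diff_smul_actDeriv IG I hF hFG g p (X p))
  have key : ∀ (a b : P), a = b → (mfderiv I I (fun p : P => g • p) a (X a) : E) =
      mfderiv I I (fun p : P => g • p) b (X b) := by rintro a _ rfl; rfl
  exact congrArg (diff I F (g • p)) (key _ _ (inv_smul_smul g p))

end Invariant

section Bump

lemma exists_contDiff_inv {a : ℝ} (ha : 0 < a) :
    ∃ θ : ℝ → ℝ, ContDiff ℝ ∞ θ ∧ ∀ s, a ≤ s → θ s * s = 1 := by
  -- `σ` is `0` for `s ≤ a / 2` and `1` for `s ≥ a`, so the denominator `s σ + (1 - σ)` interpolates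
  -- between `1` and `s` and never vanishes.
  let σ : ℝ → ℝ := fun s => Real.smoothTransition (2 * s / a - 1)
  have hσ : ContDiff ℝ ∞ σ := Real.smoothTransition.contDiff.comp (by fun_prop)
  refine ⟨fun s => (s * σ s + (1 - σ s))⁻¹, ContDiff.inv (by fun_prop) fun s => ?_, fun s hs => ?_⟩
  · rcases le_or_gt s 0 with h | h
    · have : σ s = 0 := Real.smoothTransition.zero_of_nonpos (by
        have : 2 * s / a ≤ 0 := div_nonpos_of_nonpos_of_nonneg (by linarith) ha.le
        linarith)
      simp [this]
    · have h0 : 0 ≤ σ s := Real.smoothTransition.nonneg _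
      have h1 : σ s ≤ 1 := Real.smoothTransition.le_one _
      rcases h0.eq_or_lt with h0 | h0
      · simp [← h0]
      · have := mul_pos h h0
        exact ne_of_gt (by linarith)
  · have : σ s = 1 := Real.smoothTransition.one_of_one_le (by
      have : 2 ≤ 2 * s / a := (le_div_iff₀ ha).2 (by linarith)
      linarith)
    have : s ≠ 0 := (ha.trans_le hs).ne'
    simp [*]

variable {EG : Type*} [NormedAddCommGroup EG] [NormedSpace ℝ EG] [FiniteDimensional ℝ EG]
  {HG : Type*} [TopologicalSpace HG] (IG : ModelWithCorners ℝ EG HG)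
  {G : Type*} [Group G] [TopologicalSpace G] [ChartedSpace HG G] [LieGroup IG ∞ G]
  {E : Type*} [NormedAddCommGroup E] [NormedSpace ℝ E] [FiniteDimensional ℝ E]
  {H : Type*} [TopologicalSpace H] (I : ModelWithCorners ℝ E H)
  {P : Type*} [TopologicalSpace P] [ChartedSpace H P] [IsManifold I ∞ P]
  [BoundarylessManifold I P] [T2Space P]
  [MulAction G P] [ContMDiffSMul IG I ∞ G P] [ProperSMul G P]

include IG

lemma exists_invariant_bump {O : Set P} (hO : IsOpen O) (hOG : ∀ (g : G) (p : P), g • p ∈ O → p ∈ O)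
    {p₀ : P} (hp₀ : p₀ ∈ O) :
    ∃ b : P → ℝ, ContMDiff I 𝓘(ℝ, ℝ) ∞ b ∧ (∀ (g : G) (p : P), b (g • p) = b p) ∧
      (∃ W, IsOpen W ∧ p₀ ∈ W ∧ ∀ p ∈ W, b p = 1) ∧
      ∃ C, IsClosed C ∧ C ⊆ O ∧ ∀ p ∉ C, b p = 0 := by
  have : IsTopologicalGroup G := topologicalGroup_of_lieGroup IG ∞
  have : LocallyCompactSpace G := Manifold.locallyCompact_of_finiteDimensional IG
  let : MeasurableSpace G := borel G
  have : BorelSpace G := ⟨rfl⟩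
  let μ : Measure G := Measure.haar
  obtain ⟨χ, -, hχO⟩ := ((SmoothBumpFunction.nhds_basis_tsupport (I := I) p₀).mem_iff).1
    (hO.mem_nhds hp₀)
  have hw := contMDiff_average (μ := μ) (G := G) IG I χ.contMDiff χ.hasCompactSupport
  have hw0 : 0 < average μ χ p₀ := average_pos χ.continuous χ.hasCompactSupport
    (fun p => χ.nonneg) (by simp)
  set w : P → ℝ := average μ χ with hwdef
  have hl : ContDiff ℝ ∞ fun s : ℝ => Real.smoothTransition (4 * s / w p₀ - 1) :=
    Real.smoothTransition.contDiff.comp (by fun_prop)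
  -- This is `1` where `w ≥ w p₀ / 2` and `0` where `w ≤ w p₀ / 4`. The second threshold is
  -- positive, while `w` vanishes off `O` because no translate of such a point meets the support of
  -- `χ`.
  refine ⟨fun p => Real.smoothTransition (4 * w p / w p₀ - 1), hl.contMDiff.comp hw,
    fun g p => by simp only [hwdef, average_smul], ⟨{p | w p₀ / 2 < w p},
      isOpen_lt continuous_const hw.continuous, half_lt_self hw0, fun p hp => ?_⟩,
    {p | w p₀ / 4 ≤ w p}, isClosed_le continuous_const hw.continuous, fun p hp => ?_, fun p hp => ?_⟩
  · refine Real.smoothTransition.one_of_one_le ?_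
    have : 2 ≤ 4 * w p / w p₀ := (le_div_iff₀ hw0).2 (by linarith [show w p₀ / 2 < w p from hp])
    linarith
  · by_contra hpO
    have : w p = 0 := average_eq_zero fun g => by
      by_contra hne
      exact hpO (hOG g p (hχO (subset_tsupport χ hne)))
    have hp' : w p₀ / 4 ≤ w p := hp
    linarith
  · refine Real.smoothTransition.zero_of_nonpos ?_
    have hp' : w p < w p₀ / 4 := not_le.1 hp
    have : 4 * w p / w p₀ ≤ 1 := (div_le_iff₀ hw0).2 (by linarith)
    linarith

lemma exists_equivariant_field {X : (p : P) → TangentSpace I p}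
    (hX : ContMDiff I I.tangent ∞ (fun p => (⟨p, X p⟩ : TangentBundle I P)))
    (hinv : ∀ (g : G) (p : P), pushforwardAction I g X p - X p ∈ orbitTangentSpace I G IG p)
    (p₀ : P) :
    ∃ Z : (p : P) → TangentSpace I p,
      ContMDiff I I.tangent ∞ (fun p => (⟨p, Z p⟩ : TangentBundle I P)) ∧
      (∀ (g : G) (p : P), actDeriv I g p (Z p) = Z (g • p)) ∧
      ∃ W, IsOpen W ∧ p₀ ∈ W ∧ ∀ F : P → ℝ, ContMDiff I 𝓘(ℝ, ℝ) ∞ F →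
        (∀ (g : G) (p : P), F (g • p) = F p) → ∀ p ∈ W, diff I F p (Z p) = diff I F p (X p) := by
  have : IsTopologicalGroup G := topologicalGroup_of_lieGroup IG ∞
  have : LocallyCompactSpace G := Manifold.locallyCompact_of_finiteDimensional IG
  let : MeasurableSpace G := borel G
  have : BorelSpace G := ⟨rfl⟩
  let μ : Measure G := Measure.haar
  let χ : SmoothBumpFunction I p₀ := Classical.arbitrary _
  have hw := contMDiff_average (μ := μ) (G := G) IG I χ.contMDiff χ.hasCompactSupport
  have hw0 : 0 < average μ χ p₀ := average_pos χ.continuous χ.hasCompactSupport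
    (fun p => χ.nonneg) (by simp)
  set w : P → ℝ := average μ χ with hwdef
  obtain ⟨θ, hθ, hθ1⟩ := exists_contDiff_inv (half_pos hw0)
  -- On the set `w > w p₀ / 2` the factor `θ (w p)` is `1 / w p`, which normalizes the weights;
  -- elsewhere it only keeps the field smooth. It is invariant, so equivariance survives.
  refine ⟨fun p => θ (w p) • averageField I μ χ X p, ?_, fun g p => ?_, {p | w p₀ / 2 < w p},
      isOpen_lt continuous_const hw.continuous, half_lt_self hw0, fun F hF hFG p hp => ?_⟩
  · exact (hθ.contMDiff.comp hw).smul_section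
      (contMDiff_averageField IG I hX χ.contMDiff χ.hasCompactSupport)
  · refine ((actDeriv I g p).map_smul (θ (w p)) (averageField I μ χ X p)).trans ?_
    have h1 := averageField_smul (μ := μ) IG I g p
      (integrable_averageField_integrand IG I hX χ.contMDiff χ.hasCompactSupport p)
    have h2 : w (g • p) = w p := average_smul g p
    simp only [h2]
    exact congrArg (fun v : E => θ (w p) • v) h1
  · refine ((diff I F p).map_smul (θ (w p)) (averageField I μ χ X p)).trans ?_
    have h1 := apply_averageField (μ := μ) IG I hX χ.contMDiff χ.hasCompactSupport p (diff I F p)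
      (fun g => diff_pushVec IG I hF hFG hinv g p)
    rw [smul_eq_mul]
    refine (congrArg (θ (w p) * ·) h1).trans ?_
    rw [← mul_assoc, hθ1 _ (le_of_lt hp), one_mul]

end Bump

end OrbitSpace

/-! ### The orbit space as a differential space, and the derivation on it -/

namespace OrbitSpace

open Set Filter

section OrbitMap

variable {G : Type*} [Group G] {P : Type*} [MulAction G P]

lemma orbitMap_surjective : Function.Surjective (orbitMap G : P → _) := Quotient.mk_surjective

lemma orbitMap_smul (g : G) (p : P) : orbitMap G (g • p) = orbitMap G p :=
  Quotient.sound (s := MulAction.orbitRel G P) ⟨g, rfl⟩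

lemma exists_smul_of_orbitMap_eq {p q : P} (h : orbitMap G p = orbitMap G q) :
    ∃ g : G, g • q = p := Quotient.exact (s := MulAction.orbitRel G P) h

lemma isOpenQuotientMap_orbitMap [TopologicalSpace P] [ContinuousConstSMul G P] :
    IsOpenQuotientMap (orbitMap G : P → _) := MulAction.isOpenQuotientMap_quotientMk

end OrbitMap

section Smooth

variable {E : Type*} [NormedAddCommGroup E] [NormedSpace ℝ E]
  {H : Type*} [TopologicalSpace H] {I : ModelWithCorners ℝ E H}
  {G : Type*} [Group G]
  {P : Type*} [TopologicalSpace P] [ChartedSpace H P] [MulAction G P]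

lemma mem_orbitSpaceSmooth {f : MulAction.orbitRel.Quotient G P → ℝ} :
    f ∈ orbitSpaceSmooth I G P ↔ ContMDiff I 𝓘(ℝ, ℝ) ∞ (fun p : P => f (orbitMap G p)) := Iff.rfl

lemma exists_mem_orbitSpaceSmooth {b : P → ℝ} (hb : ContMDiff I 𝓘(ℝ, ℝ) ∞ b)
    (hbG : ∀ (g : G) (p : P), b (g • p) = b p) :
    ∃ f ∈ orbitSpaceSmooth I G P, ∀ p, f (orbitMap G p) = b p := by
  refine ⟨Quotient.lift b ?_, hb, fun p => rfl⟩
  rintro _ q ⟨g, rfl⟩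
  exact hbG g q

end Smooth

section DifferentialSpace

variable {EG : Type*} [NormedAddCommGroup EG] [NormedSpace ℝ EG] [FiniteDimensional ℝ EG]
  {HG : Type*} [TopologicalSpace HG] (IG : ModelWithCorners ℝ EG HG)
  {G : Type*} [Group G] [TopologicalSpace G] [ChartedSpace HG G] [LieGroup IG ∞ G]
  {E : Type*} [NormedAddCommGroup E] [NormedSpace ℝ E] [FiniteDimensional ℝ E]
  {H : Type*} [TopologicalSpace H] (I : ModelWithCorners ℝ E H)
  {P : Type*} [TopologicalSpace P] [ChartedSpace H P] [IsManifold I ∞ P]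
  [BoundarylessManifold I P] [T2Space P]
  [MulAction G P] [ContMDiffSMul IG I ∞ G P] [ProperSMul G P]

include IG

lemma exists_bump {U : Set (MulAction.orbitRel.Quotient G P)} (hU : IsOpen U)
    {y : MulAction.orbitRel.Quotient G P} (hy : y ∈ U) :
    ∃ f ∈ orbitSpaceSmooth I G P, (∃ V, IsOpen V ∧ y ∈ V ∧ ∀ x ∈ V, f x = 1) ∧
      ∃ C, IsClosed C ∧ C ⊆ U ∧ ∀ x ∉ C, f x = 0 := by
  obtain ⟨p₀, rfl⟩ := orbitMap_surjective y
  have hρ := isOpenQuotientMap_orbitMap (G := G) (P := P)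
  obtain ⟨b, hb, hbG, ⟨W, hW, hpW, hbW⟩, C, hC, hCU, hbC⟩ :=
    exists_invariant_bump IG I (G := G) (hU.preimage hρ.continuous)
      (fun g p hp => by rwa [mem_preimage, orbitMap_smul] at hp) hy
  obtain ⟨f, hf, hfb⟩ := exists_mem_orbitSpaceSmooth hb hbG
  -- The orbit map is open, so the complement of the image of `Cᶜ` is closed, whereas the image of
  -- `C` is not known to be.
  refine ⟨f, hf, ⟨orbitMap G '' W, hρ.isOpenMap _ hW, mem_image_of_mem _ hpW, ?_⟩,
    (orbitMap G '' Cᶜ)ᶜ, (hρ.isOpenMap _ hC.isOpen_compl).isClosed_compl, ?_, ?_⟩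
  · rintro _ ⟨p, hp, rfl⟩
    rw [hfb, hbW p hp]
  · intro x hx
    obtain ⟨p, rfl⟩ := orbitMap_surjective x
    by_contra hpU
    exact hx ⟨p, fun hpC => hpU (hCU hpC), rfl⟩
  · intro x hx
    obtain ⟨p, hp, rfl⟩ := not_not.1 hx
    rw [hfb, hbC p hp]

theorem isDifferentialStructure_orbitSpaceSmooth :
    DiffSpace.IsDifferentialStructure (orbitSpaceSmooth I G P) := by
  have hρ := isOpenQuotientMap_orbitMap (G := G) (P := P)
  have hcont : ∀ f ∈ orbitSpaceSmooth I G P, Continuous f := fun f hf =>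
    hρ.isQuotientMap.continuous_iff.2 (ContMDiff.continuous hf)
  refine ⟨hcont, le_antisymm (le_generateFrom ?_) fun U hU => ?_, fun n F hF f hf => ?_,
    fun f hf => ?_⟩
  · rintro _ ⟨f, hf, a, b, rfl⟩
    exact isOpen_Ioo.preimage (hcont f hf)
  · refine @isOpen_iff_forall_mem_open _ (_) U |>.2 fun y hy => ?_
    obtain ⟨f, hf, ⟨V, -, hyV, hfV⟩, C, -, hCU, hfC⟩ := exists_bump IG I hU hy
    refine ⟨f ⁻¹' Ioo 0 2, fun x hx => hCU ?_,
      TopologicalSpace.isOpen_generateFrom_of_mem ⟨f, hf, 0, 2, rfl⟩, ?_⟩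
    · by_contra hxC
      exact absurd hx.1 (by simp [hfC x hxC])
    · simp [hfV y hyV]
  · exact hF.contMDiff.comp (contMDiff_pi_space.2 hf)
  · intro p
    obtain ⟨U, hU, hpU, g, hg, hfg⟩ := hf (orbitMap G p)
    refine (ContMDiff.contMDiffAt hg).congr_of_eventuallyEq ?_
    filter_upwards [(hU.preimage hρ.continuous).mem_nhds hpU] with q hq using hfg hq

/-- Multiply by a bump that is `1` near `y` and vanishes off a closed subset of `U`. This makes
smoothness on the orbit space a local question on `P`. -/
lemma exists_local_extension {U : Set (MulAction.orbitRel.Quotient G P)} (hU : IsOpen U)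
    {y : MulAction.orbitRel.Quotient G P} (hy : y ∈ U) {k : MulAction.orbitRel.Quotient G P → ℝ}
    (hk : ∀ p, orbitMap G p ∈ U → ContMDiffAt I 𝓘(ℝ, ℝ) ∞ (fun p : P => k (orbitMap G p)) p) :
    ∃ V, IsOpen V ∧ y ∈ V ∧ ∃ g ∈ orbitSpaceSmooth I G P, ∀ x ∈ V, k x = g x := by
  have hρ := isOpenQuotientMap_orbitMap (G := G) (P := P)
  obtain ⟨f, hf, ⟨V, hV, hyV, hfV⟩, C, hC, hCU, hfC⟩ := exists_bump IG I hU hy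
  refine ⟨V, hV, hyV, fun x => f x * k x, fun p => ?_, fun x hx => by simp [hfV x hx]⟩
  by_cases hp : orbitMap G p ∈ U
  · exact (ContMDiff.contMDiffAt hf).mul (hk p hp)
  · refine (contMDiffAt_const (c := (0 : ℝ))).congr_of_eventuallyEq ?_
    filter_upwards [(hC.isOpen_compl.preimage hρ.continuous).mem_nhds fun h => hp (hCU h)]
      with q hq
    rw [hfC _ hq, zero_mul]

end DifferentialSpace

section Derivation

variable {EG : Type*} [NormedAddCommGroup EG] [NormedSpace ℝ EG]
  {HG : Type*} [TopologicalSpace HG] (IG : ModelWithCorners ℝ EG HG)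
  {G : Type*} [Group G] [TopologicalSpace G] [ChartedSpace HG G] [LieGroup IG ∞ G]
  {E : Type*} [NormedAddCommGroup E] [NormedSpace ℝ E]
  {H : Type*} [TopologicalSpace H] (I : ModelWithCorners ℝ E H)
  {P : Type*} [TopologicalSpace P] [ChartedSpace H P] [IsManifold I ∞ P]
  [MulAction G P] [ContMDiffSMul IG I ∞ G P]

lemma contMDiff_diff_apply {X : (p : P) → TangentSpace I p}
    (hX : ContMDiff I I.tangent ∞ (fun p => (⟨p, X p⟩ : TangentBundle I P))) {F : P → ℝ}
    (hF : ContMDiff I 𝓘(ℝ, ℝ) ∞ F) : ContMDiff I 𝓘(ℝ, ℝ) ∞ (fun p => diff I F p (X p)) := by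
  have h1 := (hF.contMDiff_tangentMap (m := ∞) (by simp)).comp hX
  have h2 := (contMDiff_snd_tangentBundle_modelSpace ℝ 𝓘(ℝ, ℝ) (n := ∞)).comp h1
  exact h2

omit [LieGroup IG ∞ G] in
include IG in
theorem exists_isPushforwardToOrbitSpace {X : (p : P) → TangentSpace I p}
    (hX : ContMDiff I I.tangent ∞ (fun p => (⟨p, X p⟩ : TangentBundle I P)))
    (hinv : ∀ (g : G) (p : P), pushforwardAction I g X p - X p ∈ orbitTangentSpace I G IG p) :
    ∃ Xbar : Derivation ℝ (orbitSpaceSmooth I G P) (orbitSpaceSmooth I G P),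
      IsPushforwardToOrbitSpace I X Xbar := by
  have hF : ∀ f : orbitSpaceSmooth I G P, ∃ d : orbitSpaceSmooth I G P, ∀ p : P,
      (d : MulAction.orbitRel.Quotient G P → ℝ) (orbitMap G p) =
        diff I (fun q : P => (f : MulAction.orbitRel.Quotient G P → ℝ) (orbitMap G q)) p (X p) := by
    intro f
    obtain ⟨d, hd, hdf⟩ := exists_mem_orbitSpaceSmooth (G := G) (contMDiff_diff_apply I hX f.2)
      (fun g p => diff_smul_field IG I f.2 (fun g p => by rw [orbitMap_smul]) hinv g p)
    exact ⟨⟨d, hd⟩, hdf⟩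
  choose D hD using hF
  have hdiff : ∀ (f : orbitSpaceSmooth I G P) (p : P), MDifferentiableAt I 𝓘(ℝ, ℝ)
      (fun q : P => (f : MulAction.orbitRel.Quotient G P → ℝ) (orbitMap G q)) p :=
    fun f p => (mem_orbitSpaceSmooth.1 f.2).mdifferentiable (by simp) p
  have hext : ∀ f g : orbitSpaceSmooth I G P, (∀ p : P,
      (f : MulAction.orbitRel.Quotient G P → ℝ) (orbitMap G p) =
      (g : MulAction.orbitRel.Quotient G P → ℝ) (orbitMap G p)) → f = g := fun f g h =>
    Subtype.ext (orbitMap_surjective.injective_comp_right (funext h))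
  have hadd : ∀ f g, D (f + g) = D f + D g := by
    intro f g
    refine hext _ _ fun p => (hD _ p).trans
      (Eq.trans ?_ (congrArg₂ (· + ·) (hD f p) (hD g p)).symm)
    exact DFunLike.congr_fun (mfderiv_add (hdiff f p) (hdiff g p)) (X p)
  have hsmul : ∀ (a : ℝ) f, D (a • f) = a • D f := by
    intro a f
    refine hext _ _ fun p => (hD _ p).trans (Eq.trans ?_ (congrArg (a * ·) (hD f p)).symm)
    exact DFunLike.congr_fun (const_smul_mfderiv (hdiff f p) a) (X p)
  have hmul : ∀ f g, D (f * g) = f • D g + g • D f := by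
    intro f g
    refine hext _ _ fun p => (hD _ p).trans (Eq.trans ?_ (congrArg₂ (· + ·)
      (congrArg ((f : MulAction.orbitRel.Quotient G P → ℝ) (orbitMap G p) * ·) (hD g p))
      (congrArg ((g : MulAction.orbitRel.Quotient G P → ℝ) (orbitMap G p) * ·) (hD f p))).symm)
    exact DFunLike.congr_fun ((hdiff f p).hasMFDerivAt.mul (hdiff g p).hasMFDerivAt).mfderiv (X p)
  exact ⟨Derivation.mk' (LinearMap.mk (AddHom.mk D hadd) hsmul) hmul, hD⟩

end Derivation

section Curve

variable {E : Type*} [NormedAddCommGroup E] [NormedSpace ℝ E]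
  {H : Type*} [TopologicalSpace H] {I : ModelWithCorners ℝ E H}
  {G : Type*} [Group G]
  {P : Type*} [TopologicalSpace P] [ChartedSpace H P] [MulAction G P]

lemma _root_.IsPushforwardToOrbitSpace.unique {X : (p : P) → TangentSpace I p}
    {Y Y' : Derivation ℝ (orbitSpaceSmooth I G P) (orbitSpaceSmooth I G P)}
    (hY : IsPushforwardToOrbitSpace I X Y) (hY' : IsPushforwardToOrbitSpace I X Y') : Y = Y' := by
  refine Derivation.ext fun f => Subtype.ext (orbitMap_surjective.injective_comp_right ?_)
  exact funext fun p => (hY f p).trans (hY' f p).symm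

lemma hasDerivWithinAt_comp_integralCurve {Z : (p : P) → TangentSpace I p} {γ : ℝ → P} {J : Set ℝ}
    (hγ : IsMIntegralCurveOn γ Z J) {F : P → ℝ} (hF : ContMDiff I 𝓘(ℝ, ℝ) ∞ F) {t : ℝ}
    (ht : t ∈ J) :
    HasDerivWithinAt (fun s => F (γ s)) (diff I F (γ t) (Z (γ t))) J t := by
  have h1 := ((hF.mdifferentiable (by simp) (γ t)).hasMFDerivAt).comp_hasMFDerivWithinAt t (hγ t ht)
  let L : ℝ →L[ℝ] ℝ :=
    (diff I F (γ t)).comp ((1 : ℝ →L[ℝ] ℝ).smulRight (Z (γ t) : E))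
  have h2 : HasFDerivWithinAt (fun s => F (γ s)) L J t :=
    hasMFDerivWithinAt_iff_hasFDerivWithinAt.1 h1
  refine h2.hasDerivWithinAt.congr_deriv ?_
  exact congrArg (diff I F (γ t)) (one_smul ℝ (Z (γ t) : E))

/-- The curve belongs to `Z`, the derivation to `X`: agreement on invariant functions along the
curve suffices. Flow boxes use the equivariant `Z`, the final statement uses `Z = X`. -/
lemma _root_.IsPushforwardToOrbitSpace.isIntegralCurve {X Z : (p : P) → TangentSpace I p}
    {Y : Derivation ℝ (orbitSpaceSmooth I G P) (orbitSpaceSmooth I G P)}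
    (hY : IsPushforwardToOrbitSpace I X Y) {γ : ℝ → P} {J : Set ℝ} (hJ : J.OrdConnected)
    (h0 : (0 : ℝ) ∈ J) (hγ : IsMIntegralCurveOn γ Z J)
    (hZ : ∀ F : P → ℝ, ContMDiff I 𝓘(ℝ, ℝ) ∞ F → (∀ (g : G) (p : P), F (g • p) = F p) →
      ∀ t ∈ J, diff I F (γ t) (Z (γ t)) = diff I F (γ t) (X (γ t))) :
    DiffSpace.IsIntegralCurve Y (orbitMap G (γ 0)) (fun t => orbitMap G (γ t)) J := by
  refine ⟨hJ, h0, rfl, fun f t ht => ?_⟩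
  refine (hasDerivWithinAt_comp_integralCurve hγ f.2 ht).congr_deriv ?_
  exact (hZ _ f.2 (fun g p => by rw [orbitMap_smul]) t ht).trans (hY f (γ t)).symm

end Curve

end OrbitSpace

/-! ### Flow boxes on the orbit space and the theorem -/

namespace OrbitSpace

open Set Filter

variable {EG : Type*} [NormedAddCommGroup EG] [NormedSpace ℝ EG] [FiniteDimensional ℝ EG]
  {HG : Type*} [TopologicalSpace HG] (IG : ModelWithCorners ℝ EG HG)
  {G : Type*} [Group G] [TopologicalSpace G] [ChartedSpace HG G] [LieGroup IG ∞ G]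
  {E : Type*} [NormedAddCommGroup E] [NormedSpace ℝ E] [FiniteDimensional ℝ E]
  {H : Type*} [TopologicalSpace H] (I : ModelWithCorners ℝ E H)
  {P : Type*} [TopologicalSpace P] [ChartedSpace H P] [IsManifold I ∞ P]
  [BoundarylessManifold I P] [T2Space P]
  [MulAction G P] [ContMDiffSMul IG I ∞ G P]

section Equivariant

omit [LieGroup IG ∞ G] [FiniteDimensional ℝ EG] [FiniteDimensional ℝ E] [IsManifold I ∞ P] [BoundarylessManifold I P]
  [T2Space P]

include IG in
lemma isMIntegralCurveOn_smul {Z : (p : P) → TangentSpace I p}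
    (hZ : ∀ (g : G) (p : P), actDeriv I g p (Z p) = Z (g • p)) (g : G) {γ : ℝ → P} {J : Set ℝ}
    (hγ : IsMIntegralCurveOn γ Z J) : IsMIntegralCurveOn (fun t => g • γ t) Z J := by
  intro t ht
  have hs : ContMDiff I I ∞ (fun p : P => g • p) :=
    (contMDiff_smul (I := IG) (I' := I) (n := ∞) (G := G) (M := P)).comp
      (contMDiff_const.prodMk contMDiff_id)
  have h1 := ((hs.mdifferentiable (by simp) (γ t)).hasMFDerivAt).comp_hasMFDerivWithinAt t (hγ t ht)
  have h2 : (actDeriv I g (γ t)).comp ((1 : ℝ →L[ℝ] ℝ).smulRight (Z (γ t) : E)) =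
      (1 : ℝ →L[ℝ] ℝ).smulRight (Z (g • γ t) : E) := by
    refine ContinuousLinearMap.ext_ring ?_
    refine Eq.trans ?_ ((hZ g (γ t)).trans (one_smul ℝ (Z (g • γ t) : E)).symm)
    exact congrArg (actDeriv I g (γ t)) (one_smul ℝ (Z (γ t) : E))
  exact ⟨h1.1, h1.2.congr_fderiv h2⟩

end Equivariant

include IG in
/-- Near each point of the orbit space, the flow of an equivariant field descends to a flow box of
the push-forward. -/
theorem hasFlowBoxes [ProperSMul G P] {X : (p : P) → TangentSpace I p}
    (hX : ContMDiff I I.tangent ∞ (fun p => (⟨p, X p⟩ : TangentBundle I P)))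
    (hinv : ∀ (g : G) (p : P), pushforwardAction I g X p - X p ∈ orbitTangentSpace I G IG p)
    {Y : Derivation ℝ (orbitSpaceSmooth I G P) (orbitSpaceSmooth I G P)}
    (hY : IsPushforwardToOrbitSpace I X Y) : DiffSpace.HasFlowBoxes Y := by
  intro x
  obtain ⟨p₀, rfl⟩ := orbitMap_surjective x
  have : Nonempty P := ⟨p₀⟩
  have hρ := isOpenQuotientMap_orbitMap (G := G) (P := P)
  obtain ⟨Z, hZ, hZG, W, hW, hpW, hZX⟩ := exists_equivariant_field IG I hX hinv p₀
  -- Shrink the local flow of `Z` so that its trajectories remain in `W`, where `Z` represents the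
  -- push-forward of `X`.
  obtain ⟨N, ε, φ, hN, hpN, hε, hφ, hφ0, hφZ, hφW⟩ : ∃ (N : Set P) (ε : ℝ) (φ : ℝ × P → P),
      IsOpen N ∧ p₀ ∈ N ∧ 0 < ε ∧
      ContMDiffOn (𝓘(ℝ, ℝ).prod I) I ∞ φ (Ioo (-ε) ε ×ˢ N) ∧ (∀ q ∈ N, φ (0, q) = q) ∧
      (∀ q ∈ N, IsMIntegralCurveOn (fun t => φ (t, q)) Z (Ioo (-ε) ε)) ∧
      ∀ q ∈ N, ∀ t ∈ Ioo (-ε) ε, φ (t, q) ∈ W := by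
    obtain ⟨N, hN, hpN, ε, hε, φ, hφ, hφZ⟩ := SmoothFlow.exists_smooth_local_flow hZ p₀
    have hmem : (0, p₀) ∈ Ioo (-ε) ε ×ˢ N := ⟨⟨neg_lt_zero.2 hε, hε⟩, hpN⟩
    have hc : ContinuousAt φ (0, p₀) :=
      hφ.continuousOn.continuousAt ((isOpen_Ioo.prod hN).mem_nhds hmem)
    obtain ⟨U, hU, V, hV, hUV⟩ := mem_nhds_prod_iff.1
      (hc (hW.mem_nhds (show φ (0, p₀) ∈ W by rwa [(hφZ p₀ hpN).1])))
    obtain ⟨δ, hδ, hδU⟩ := Metric.mem_nhds_iff.1 hU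
    rw [Real.ball_eq_Ioo, zero_sub, zero_add] at hδU
    obtain ⟨V', hV'V, hV', hpV'⟩ := mem_nhds_iff.1 hV
    have hsub : Ioo (-min ε δ) (min ε δ) ⊆ Ioo (-ε) ε :=
      Ioo_subset_Ioo (neg_le_neg (min_le_left _ _)) (min_le_left _ _)
    refine ⟨N ∩ V', min ε δ, φ, hN.inter hV', ⟨hpN, hpV'⟩, lt_min hε hδ,
      hφ.mono (prod_mono hsub inter_subset_left), fun q hq => (hφZ q hq.1).1,
      fun q hq => (hφZ q hq.1).2.mono hsub, fun q hq t ht => hUV ⟨hδU ?_, hV'V hq.2⟩⟩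
    exact Ioo_subset_Ioo (neg_le_neg (min_le_right _ _)) (min_le_right _ _) ht
  have h0 : (0 : ℝ) ∈ Ioo (-ε) ε := ⟨neg_lt_zero.2 hε, hε⟩
  -- Equivariance and the group law at once: as functions of `s` both sides are integral curves of
  -- `Z` agreeing at `s = 0`. With `r = 0` it shows independence of the representative, with general
  -- `r` the group law downstairs.
  have hequi : ∀ q ∈ N, ∀ q' ∈ N, ∀ r ∈ Ioo (-ε) ε, ∀ g : G, φ (r, q) = g • q' →
      ∀ s ∈ Ioo (-ε) ε, s + r ∈ Ioo (-ε) ε → φ (s + r, q) = g • φ (s, q') := by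
    intro q hq q' hq' r hr g hg s hs hsr
    have h1 := (hφZ q hq).comp_add r
    have h2 := isMIntegralCurveOn_smul IG I hZG g (hφZ q' hq')
    have hsub : Ioo (max (-ε) (-ε - r)) (min ε (ε - r)) ⊆ Ioo (-ε) ε ∩ {t | t + r ∈ Ioo (-ε) ε} := by
      intro t ht
      rw [mem_Ioo, max_lt_iff, lt_min_iff] at ht
      exact ⟨⟨ht.1.1, ht.2.1⟩, by linarith [ht.1.2], by linarith [ht.2.2]⟩
    have hsup : ∀ t, t ∈ Ioo (-ε) ε → t + r ∈ Ioo (-ε) ε →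
        t ∈ Ioo (max (-ε) (-ε - r)) (min ε (ε - r)) := by
      intro t ht ht'
      rw [mem_Ioo, max_lt_iff, lt_min_iff]
      exact ⟨⟨ht.1, by linarith [ht'.1]⟩, ht.2, by linarith [ht'.2]⟩
    refine isMIntegralCurveOn_Ioo_eqOn_of_contMDiff_boundaryless (t₀ := 0)
      (hsup 0 h0 (by rwa [zero_add])) (hZ.of_le (by simp))
      (h1.mono (hsub.trans inter_subset_right)) (h2.mono (hsub.trans inter_subset_left)) ?_
      (hsup s hs hsr)
    simp only [Function.comp_apply, zero_add, hφ0 q' hq', hg]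
  -- An arbitrary choice of representatives in `N`, with no continuity; regularity of `Φ` comes from
  -- `hΦ`, which allows any representative.
  let σ : MulAction.orbitRel.Quotient G P → P := Function.invFunOn (orbitMap G) N
  let Φ : ℝ → MulAction.orbitRel.Quotient G P → MulAction.orbitRel.Quotient G P :=
    fun t y => orbitMap G (φ (t, σ y))
  have hΦ : ∀ q ∈ N, ∀ t ∈ Ioo (-ε) ε, Φ t (orbitMap G q) = orbitMap G (φ (t, q)) := by
    intro q hq t ht
    have hmem : orbitMap G q ∈ orbitMap G '' N := mem_image_of_mem _ hq
    obtain ⟨g, hg⟩ := exists_smul_of_orbitMap_eq (Function.invFunOn_eq hmem)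
    have h1 := hequi _ (Function.invFunOn_mem hmem) q hq 0 h0 g
      (by rw [hφ0 _ (Function.invFunOn_mem hmem), hg]) t ht (by rwa [add_zero])
    rw [add_zero] at h1
    exact (congrArg (orbitMap G) h1).trans (orbitMap_smul g _)
  refine ⟨orbitMap G '' N, ε, Φ, mem_image_of_mem _ hpN, hρ.isOpenMap _ hN, hε, ?_, ?_, ?_, ?_⟩
  · rintro _ ⟨q, hq, rfl⟩
    have h1 := hY.isIntegralCurve ordConnected_Ioo h0 (hφZ q hq) fun F hF hFG t ht =>
      hZX F hF hFG _ (hφW q hq t ht)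
    rw [hφ0 q hq] at h1
    exact h1.congr fun t ht => hΦ q hq t ht
  · rintro ⟨t, _⟩ ⟨ht, q, hq, rfl⟩
    refine ContinuousAt.continuousWithinAt ?_
    have h1 : ContinuousAt φ (t, q) :=
      hφ.continuousOn.continuousAt ((isOpen_Ioo.prod hN).mem_nhds ⟨ht, hq⟩)
    have h2 : Tendsto (fun z : ℝ × P => Φ z.1 (orbitMap G z.2)) (𝓝 (t, q))
        (𝓝 (Φ t (orbitMap G q))) := by
      rw [hΦ q hq t ht]
      refine ((hρ.continuous.tendsto _).comp h1).congr' ?_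
      filter_upwards [(isOpen_Ioo.prod hN).mem_nhds ⟨ht, hq⟩] with z hz
      exact (hΦ z.2 hz.2 z.1 hz.1).symm
    -- Since `id × ρ` is open, neighbourhoods downstairs are images of those upstairs, and
    -- continuity can be tested on `ℝ × P`.
    have h3 := (IsOpenMap.id.prodMap hρ.isOpenMap : IsOpenMap
      (Prod.map (id : ℝ → ℝ) (orbitMap G : P → _))).nhds_le (t, q)
    have h4 : Tendsto (fun z : ℝ × MulAction.orbitRel.Quotient G P => Φ z.1 z.2)
        (map (Prod.map id (orbitMap G)) (𝓝 (t, q))) (𝓝 (Φ t (orbitMap G q))) :=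
      tendsto_map'_iff.2 h2
    exact h4.mono_left h3
  · rintro t ht f hf x hx
    have hk : ∀ p, orbitMap G p ∈ orbitMap G '' N →
        ContMDiffAt I 𝓘(ℝ, ℝ) ∞ (fun p : P => f (Φ t (orbitMap G p))) p := by
      -- The point `p` lies over the image of `N` but perhaps not in `N`; a group element brings it
      -- there without changing its orbit.
      rintro p ⟨q, hq, hqp⟩
      obtain ⟨g, rfl⟩ := exists_smul_of_orbitMap_eq hqp
      have hg := contMDiff_smul_left IG I (P := P) g
      have h1 : ContMDiffAt I I ∞ (fun p' : P => φ (t, g • p')) p := by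
        refine ContMDiffAt.comp p (g := φ) (f := fun p' : P => (t, g • p'))
          (hφ.contMDiffAt ((isOpen_Ioo.prod hN).mem_nhds ⟨ht, hq⟩)) ?_
        exact contMDiffAt_const.prodMk hg.contMDiffAt
      refine ((ContMDiff.contMDiffAt hf).comp p h1).congr_of_eventuallyEq ?_
      filter_upwards [hg.continuous.continuousAt (hN.mem_nhds hq)] with p' hp'
      rw [← orbitMap_smul g p', hΦ _ hp' t ht]
      rfl
    obtain ⟨V, hV, hxV, g, hg, hgV⟩ :=
      exists_local_extension IG I (hρ.isOpenMap _ hN) hx (k := fun y => f (Φ t y)) hk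
    exact ⟨V, hV, hxV, g, hg, fun y hy => hgV y hy.1⟩
  · rintro _ ⟨q, hq, rfl⟩ r hr hmem s hs hsr
    rw [hΦ q hq r hr] at hmem ⊢
    obtain ⟨q', hq', hqq⟩ := hmem
    obtain ⟨g, hg⟩ := exists_smul_of_orbitMap_eq hqq.symm
    rw [← hqq, hΦ q' hq' s hs, hΦ q hq _ hsr, hequi q hq q' hq' r hr g hg.symm s hs hsr,
      orbitMap_smul]

end OrbitSpace

theorem mainTheorem1
    {EG : Type*} [NormedAddCommGroup EG] [NormedSpace ℝ EG] [FiniteDimensional ℝ EG]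
    {HG : Type*} [TopologicalSpace HG] (IG : ModelWithCorners ℝ EG HG)
    {G : Type*} [Group G] [TopologicalSpace G] [ChartedSpace HG G] [LieGroup IG ∞ G]
    [BoundarylessManifold IG G] [ConnectedSpace G]
    {E : Type*} [NormedAddCommGroup E] [NormedSpace ℝ E] [FiniteDimensional ℝ E]
    {H : Type*} [TopologicalSpace H] (I : ModelWithCorners ℝ E H)
    {P : Type*} [TopologicalSpace P] [ChartedSpace H P] [IsManifold I ∞ P]
    [BoundarylessManifold I P] [T2Space P] [ParacompactSpace P]
    [MulAction G P] [ContMDiffSMul IG I ∞ G P] [ProperSMul G P]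
    (X : (p : P) → TangentSpace I p)
    (hX : ContMDiff I I.tangent ∞ (fun p => (⟨p, X p⟩ : TangentBundle I P)))
    (hinv : ∀ (g : G) (p : P), pushforwardAction I g X p - X p ∈ orbitTangentSpace I G IG p) :
    DiffSpace.IsDifferentialStructure (orbitSpaceSmooth I G P) ∧
    ∃ Xbar : Derivation ℝ (orbitSpaceSmooth I G P) (orbitSpaceSmooth I G P),
      IsPushforwardToOrbitSpace I X Xbar ∧
      (∀ Y, IsPushforwardToOrbitSpace I X Y → Y = Xbar) ∧
      DiffSpace.IsVectorField Xbar ∧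
      ∀ (γ : ℝ → P) (J : Set ℝ), J.OrdConnected → (0 : ℝ) ∈ J → IsMIntegralCurveOn γ X J →
        ∀ t ∈ J, orbitMap G (γ 0) ∈ DiffSpace.expDomain Xbar t ∧
          orbitMap G (γ t) = DiffSpace.exp Xbar t (orbitMap G (γ 0)) := by
  have : ContinuousSMul G P :=
    ⟨(contMDiff_smul (I := IG) (I' := I) (n := ∞) (G := G) (M := P)).continuous⟩
  have hA := OrbitSpace.isDifferentialStructure_orbitSpaceSmooth IG I (G := G) (P := P)
  obtain ⟨Xbar, hXbar⟩ := OrbitSpace.exists_isPushforwardToOrbitSpace IG I hX hinv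
  have hB := OrbitSpace.hasFlowBoxes IG I hX hinv hXbar
  refine ⟨hA, Xbar, hXbar, fun Y hY => hY.unique hXbar, hB.isVectorField hA,
    fun γ J hJ h0 hγ t ht => ?_⟩
  -- Here the curve belongs to `X` itself, so agreement on invariant functions is trivial and no
  -- equivariance is needed.
  have hc := hXbar.isIntegralCurve hJ h0 hγ fun F hF hFG s hs => rfl
  exact ⟨hc.mem_expDomain ht, (hc.exp_eq hA (hB.locallyUniqueCurves hA) ht).symm⟩
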